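/- **Notation.** A spinor is a vector $\kappa=(\xi,\eta)\in\mathbb C^2$ (a column), and for spinors $\kappa_i=(\xi_i,\eta_i)$ put $\{\kappa_1,\kappa_2\}=\det\begin{pmatrix}\xi_1&\xi_2\\ \eta_1&\eta_2\end{pmatrix}=\xi_1\eta_2-\xi_2\eta_1$. Minkowski space $\mathbb R^{1,3}$ has coordinates $(T,X,Y,Z)$ and form $\langle p,p'\rangle=TT'-XX'-YY'-ZZ'$. Hyperbolic 3-space is used in the hyperboloid model $\mathbb H=\{x:\langle x,x\rangle=1,\ T>0\}$, the conformal ball model $\mathbb D$, and the upper half space model $\mathbb U=\{(x,y,z):z>0\}$ with boundary $\mathbb C\cup\{\infty\}$. The isometry $\mathbb H\to\mathbb D$ is $(T,X,Y,Z)\mapsto (X,Y,Z)/(1+T)$, and the isometry $\mathbb D\to\mathbb U$ is the one extending the map $(x,y,z)\mapsto (x+yi)/(1-z)$ of boundary spheres. $SL(2,\mathbb C)$ acts on $\mathbb U$ by isometries; on $\mathbb R^{1,3}$, identified with the Hermitian matrices by the map $\mathbf g$ below, the action is $S\mapsto ASA^*$, and on the boundary it is by Möbius transformations. **Decorated horospheres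 from spinors.** For $\kappa=(\xi,\eta)\neq0$ let $\mathbf f(\kappa)=\kappa\kappa^*$ and $\mathcal Z(\kappa)=(i\bar\eta,-i\bar\xi)$, let $D_\kappa\mathbf f(\nu)=\kappa\nu^*+\nu\kappa^*$ be the derivative of $\mathbf f$ at $\kappa$ in the direction $\nu$, and let $\mathbf g$ be the linear map $\begin{pmatrix}a&b+ci\\ b-ci&d\end{pmatrix}\mapsto(a+d,2b,2c,a-d)$ from Hermitian matrices to $\mathbb R^{1,3}$. Put $p=\mathbf g(\mathbf f(\kappa))$ and $v=\mathbf g(D_\kappa\mathbf f(\mathcal Z(\kappa)))$, and let $V$ be the plane spanned by $p$ and $v$, with $V/\mathbb Rp$ oriented by $v$. On the horosphere $\{x\in\mathbb H:\langle x,p\rangle=1\}$, the intersections of $V$ with the tangent planes of the horosphere form an oriented line field. Let $\mathbf K(\kappa)$ be the image in $\mathbb U$ of this horosphere with this oriented line field. **Spin decorations.** A frame on $\mathbb U$ is a right-handed orthonormal triple of tangent vectors at a point. The space of spin frames is the double (universal) cover of the space of frames, identified with $SL(2,\mathbb C)$ so that $A\in SL(2,\mathbb C)$ lies over the image under $A$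 of the frame $(e_z,e_y,-e_x)$ at $(0,0,1)$. A path of isometries starting at the identity lifts to $SL(2,\mathbb C)$ and so acts on spin frames; in particular one may rotate a spin frame by an angle about an axis, and translate it along a geodesic, with rotation by $2\pi$ acting as $-1$. A tangent vector field on a horosphere is called parallel if it is invariant under all parabolic isometries preserving the horosphere. A spin decoration on a horosphere $h$ is a pair $W=(W^{in},W^{out})$ of continuous fields of spin frames along $h$ such that, for some unit parallel tangent vector field $\mathcal V$ on $h$, $W^{out}$ lifts the frame field $(N,\mathcal V,N\times\mathcal V)$, where $N$ is the unit normal pointing towards the centre of $h$, $W^{in}$ lifts $(-N,\mathcal V,-N\times\mathcal V)$, and $W^{in}$ is obtained from $W^{out}$ by rotation by $\pi$ about $\mathcal V$ (right-handed). The spin-decorated horosphere $(h,W)$ projects to $h$ together with the line field directed by $\mathcal V$. Let $\widetilde{\mathbf K}$ be a continuous lift of $\mathbf K$ (defined on $\mathbb C^2\setminus\{0\}$) to spin-decorated horospheres, where continuity means that the spin frames $W^{in},W^{out}$ of $\widetilde{\mathbf K}(\kappa)$ at a point $q$ of the horosphere depend continuously on $(\kappa,q)$. **Complex lambda length.** If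 two spin frames $F_1,F_2$ are adapted to an oriented geodesic $\gamma$ (their base points lie on $\gamma$ and their first vectors are positively tangent to $\gamma$), the complex distance from $F_1$ to $F_2$ is the $d=\rho+i\theta$, well defined modulo $4\pi i$, such that translating $F_1$ along $\gamma$ by signed distance $\rho$ and rotating it (right-handed) about $\gamma$ by the angle $\theta$ gives $F_2$. Let $(h_1,W_1),(h_2,W_2)$ be spin-decorated horospheres with centres $p_1,p_2$. If $p_1\neq p_2$, let $\gamma_{12}$ be the oriented geodesic from $p_1$ to $p_2$, let $q_i=\gamma_{12}\cap h_i$, and let $d$ be the complex distance along $\gamma_{12}$ from $W_1^{in}(q_1)$ to $W_2^{out}(q_2)$; the complex lambda length from $(h_1,W_1)$ to $(h_2,W_2)$ is $\lambda_{12}=\exp(d/2)$. If $p_1=p_2$, then $\lambda_{12}=0$. **Theorem.** A continuous lift $\widetilde{\mathbf K}$ of $\mathbf K$ exists, and for every such lift and all nonzero spinors $\kappa_1,\kappa_2$, the complex lambda length from $\widetilde{\mathbf K}(\kappa_1)$ to $\widetilde{\mathbf K}(\kappa_2)$ is well defined and $$\lambda_{12}=\{\kappa_1,\kappa_2\}=\xi_1\eta_2-\xi_2\eta_1.$$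 -/

import Mathlib

open Matrix

namespace SpinHoro

noncomputable section

/-! ### Ambient spaces -/

/-- Spinors `κ = (ξ, η)`, with `ξ = κ 0` and `η = κ 1`. -/
abbrev Spinor := Fin 2 → ℂ

/-- Minkowski space `ℝ^{1,3}` with coordinates `(T, X, Y, Z)`. -/
abbrev Mink := Fin 4 → ℝ

/-- The space `ℝ³` containing both the conformal ball and the upper half space. -/
abbrev Space := Fin 3 → ℝ

/-- The group `SL(2, ℂ)`. -/
abbrev SL2C := Matrix.SpecialLinearGroup (Fin 2) ℂ

/-- The real vector space of `2 × 2` Hermitian matrices. -/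
abbrev Herm := selfAdjoint (Matrix (Fin 2) (Fin 2) ℂ)

/-- The determinant `{κ₁, κ₂} = ξ₁ η₂ - ξ₂ η₁`. -/
def spinorDet (κ₁ κ₂ : Spinor) : ℂ := κ₁ 0 * κ₂ 1 - κ₂ 0 * κ₁ 1

theorem spinorDet_eq_det (κ₁ κ₂ : Spinor) :
    spinorDet κ₁ κ₂ = (!![κ₁ 0, κ₂ 0; κ₁ 1, κ₂ 1] : Matrix (Fin 2) (Fin 2) ℂ).det := by
  simp [spinorDet, Matrix.det_fin_two]

/-! ### Spinors to Hermitian matrices -/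

/-- `f(κ) = κ κ*`. -/
def f (κ : Spinor) : Herm :=
  ⟨vecMulVec κ (star κ), by
    rw [selfAdjoint.mem_iff, star_eq_conjTranspose, conjTranspose_vecMulVec, star_star]⟩

/-- The real derivative of `f` at `κ` in the direction `ν`, namely `κ ν* + ν κ*`. -/
def Df (κ ν : Spinor) : Herm :=
  ⟨vecMulVec κ (star ν) + vecMulVec ν (star κ), by
    rw [selfAdjoint.mem_iff, star_eq_conjTranspose, conjTranspose_add, conjTranspose_vecMulVec,
      conjTranspose_vecMulVec, star_star, star_star, add_comm]⟩

/-- `Df κ ν` is the directional derivative of `f` at `κ` in the direction `ν`. -/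
theorem hasDerivAt_f (κ ν : Spinor) (a b : Fin 2) :
    HasDerivAt (fun s : ℝ => (f (κ + s • ν) : Matrix (Fin 2) (Fin 2) ℂ) a b)
      ((Df κ ν : Matrix (Fin 2) (Fin 2) ℂ) a b) 0 := by
  have h : ∀ c : Fin 2, HasDerivAt (fun s : ℝ => κ c + (s : ℂ) * ν c) (ν c) 0 := fun c => by
    simpa using ((Complex.ofRealCLM.hasDerivAt (x := (0 : ℝ))).mul_const (ν c)).const_add (κ c)
  have h2 : ∀ c : Fin 2, HasDerivAt (fun s : ℝ => star (κ c + (s : ℂ) * ν c)) (star (ν c)) 0 :=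
    fun c => (h c).star
  have h3 := (h a).mul (h2 b)
  simp only [Complex.ofReal_zero, zero_mul, add_zero] at h3
  refine (h3.congr_deriv ?_).congr_of_eventuallyEq (Filter.Eventually.of_forall fun s => ?_)
  · simp [Df, vecMulVec_apply]; ring
  · simp [f, vecMulVec_apply]

/-- `Z(ξ, η) = (i η̄, -i ξ̄)`. -/
def Zmap (κ : Spinor) : Spinor := ![Complex.I * star (κ 1), -Complex.I * star (κ 0)]

/-! ### Flags -/

/-- A pointed oriented flag in a real vector space: a vector `point`, a plane `plane` containing
it, and an orientation of the quotient `plane / ℝ point`, recorded as the set `pos` of those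
vectors of the plane that represent positive elements of the quotient. -/
structure Flag (E : Type) [AddCommGroup E] [Module ℝ E] where
  point : E
  plane : Submodule ℝ E
  pos : Set E

/-- The flag `[[p, v]]` whose plane is spanned by `p` and `v`, with `plane / ℝ p` oriented
by `v`. -/
def Flag.ofPair {E : Type} [AddCommGroup E] [Module ℝ E] (p v : E) : Flag E where
  point := p
  plane := Submodule.span ℝ {p, v}
  pos := {w | ∃ a b : ℝ, 0 < b ∧ w = a • p + b • v}

/-- The image of a flag under a linear map. -/
def Flag.map {E E' : Type} [AddCommGroup E] [Module ℝ E] [AddCommGroup E'] [Module ℝ E']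
    (φ : E →ₗ[ℝ] E') (F : Flag E) : Flag E' where
  point := φ F.point
  plane := F.plane.map φ
  pos := φ '' F.pos

/-- `F(κ) = [[f(κ), D_κ f(Z(κ))]]`. -/
def flagF (κ : Spinor) : Flag Herm := Flag.ofPair (f κ) (Df κ (Zmap κ))

/-- The isomorphism `g` from Hermitian matrices to Minkowski space, sending
`[[a, b + c i], [b - c i, d]]` to `(a + d, 2 b, 2 c, a - d)`. -/
def g : Herm →ₗ[ℝ] Mink where
  toFun S := ![(S.1 0 0).re + (S.1 1 1).re, 2 * (S.1 0 1).re, 2 * (S.1 0 1).im,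
    (S.1 0 0).re - (S.1 1 1).re]
  map_add' S S' := by
    ext k; fin_cases k <;> simp <;> ring
  map_smul' c S := by
    ext k; fin_cases k <;> simp <;> ring

/-- The inverse of `g`, as a matrix. -/
def gInv (v : Mink) : Matrix (Fin 2) (Fin 2) ℂ :=
  !![((v 0 + v 3) / 2 : ℂ), ((v 1 + v 2 * Complex.I) / 2 : ℂ);
    ((v 1 - v 2 * Complex.I) / 2 : ℂ), ((v 0 - v 3) / 2 : ℂ)]

theorem gInv_isSelfAdjoint (v : Mink) : gInv v ∈ selfAdjoint (Matrix (Fin 2) (Fin 2) ℂ) := by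
  rw [selfAdjoint.mem_iff]
  ext a b
  fin_cases a <;> fin_cases b <;> simp [gInv, sub_eq_add_neg]

theorem g_gInv (v : Mink) : g ⟨gInv v, gInv_isSelfAdjoint v⟩ = v := by
  ext k; fin_cases k <;> simp [g, gInv] <;> ring

theorem gInv_g (S : Herm) : gInv (g S) = S.1 := by
  have h := S.2
  rw [selfAdjoint.mem_iff] at h
  have h0 : star (S.1 0 0) = S.1 0 0 := congrFun (congrFun h 0) 0
  have h1 : star (S.1 1 1) = S.1 1 1 := congrFun (congrFun h 1) 1
  have h2 : star (S.1 0 1) = S.1 1 0 := congrFun (congrFun h 1) 0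
  have h0i := Complex.conj_eq_iff_im.1 h0
  have h1i := Complex.conj_eq_iff_im.1 h1
  have h2r := congrArg Complex.re h2
  have h2i := congrArg Complex.im h2
  simp only [Complex.star_def, Complex.conj_re, Complex.conj_im] at h2r h2i
  ext a b
  fin_cases a <;> fin_cases b <;> apply Complex.ext <;>
    simp [gInv, g, h0i, h1i, ← h2r, ← h2i]
  ring

/-- The map `G` on flags induced by `g`. -/
def flagG (F : Flag Herm) : Flag Mink := F.map g

/-! ### The hyperboloid model and line fields -/

/-- The Minkowski form `T T' - X X' - Y Y' - Z Z'`. -/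
def mform (v w : Mink) : ℝ := v 0 * w 0 - v 1 * w 1 - v 2 * w 2 - v 3 * w 3

/-- The positive light cone. -/
def lightCone : Set Mink := {p | mform p p = 0 ∧ 0 < p 0}

/-- The hyperboloid model of hyperbolic 3-space. -/
def hyperboloid : Set Mink := {x | mform x x = 1 ∧ 0 < x 0}

/-- The horosphere `h(p)` in the hyperboloid model. -/
def horoH (p : Mink) : Set Mink := {x | x ∈ hyperboloid ∧ mform x p = 1}

/-- The tangent space at `x` to the horosphere `h(p)`: the Minkowski orthogonal complement of
`x` and `p`. -/
def horoTangentH (p x : Mink) : Set Mink := {v | mform x v = 0 ∧ mform p v = 0}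

/-- A surface with an oriented line field: at each point `x`, `dir x` is the set of positively
directed vectors of the oriented line at `x`. -/
structure LineFieldOn (E : Type) where
  carrier : Set E
  dir : E → Set E

/-- The image under `φ`: the line field is pushed forward by the derivative of `φ`. -/
def LineFieldOn.map {E E' : Type} [NormedAddCommGroup E] [NormedSpace ℝ E]
    [NormedAddCommGroup E'] [NormedSpace ℝ E'] (φ : E → E') (L : LineFieldOn E) :
    LineFieldOn E' where
  carrier := φ '' L.carrier
  dir y := {w | ∃ x ∈ L.carrier, φ x = y ∧ ∃ v ∈ L.dir x, fderiv ℝ φ x v = w}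

/-- The map `H` from flags `(p, V, o)` to decorated horospheres: on the horosphere `h(p)`, the
line field whose line at `x` is the intersection of `V` with the tangent space of the horosphere,
oriented by `o`. -/
def flagH (F : Flag Mink) : LineFieldOn Mink where
  carrier := horoH F.point
  dir x := {v | v ∈ F.plane ∧ v ∈ horoTangentH F.point x ∧ v ∈ F.pos}

/-! ### The conformal ball and upper half space models -/

/-- The isometry `i` from the hyperboloid to the conformal ball, `(X, Y, Z) / (1 + T)`. -/
def iMap (v : Mink) : Space := ![v 1 / (1 + v 0), v 2 / (1 + v 0), v 3 / (1 + v 0)]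

/-- The inverse of `iMap`. -/
def iInv (x : Space) : Mink :=
  ![(1 + x ⬝ᵥ x) / (1 - x ⬝ᵥ x), 2 * x 0 / (1 - x ⬝ᵥ x), 2 * x 1 / (1 - x ⬝ᵥ x),
    2 * x 2 / (1 - x ⬝ᵥ x)]

/-- The isometry `j` from the conformal ball to the upper half space
`{(x, y, z) | 0 < z}`, extending the stereographic projection `(x + y i) / (1 - z)` of the
boundary spheres. -/
def jMap (x : Space) : Space :=
  let D := x 0 ^ 2 + x 1 ^ 2 + (1 - x 2) ^ 2
  ![2 * x 0 / D, 2 * x 1 / D, (1 - x ⬝ᵥ x) / D]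

/-- The inverse of `jMap`. -/
def jInv (x : Space) : Space :=
  let D := x 0 ^ 2 + x 1 ^ 2 + (x 2 + 1) ^ 2
  ![2 * x 0 / D, 2 * x 1 / D, (x ⬝ᵥ x - 1) / D]

theorem iInv_iMap (v : Mink) (hv : v ∈ hyperboloid) : iInv (iMap v) = v := by
  obtain ⟨h1, h2⟩ := hv
  simp only [mform] at h1
  have h3 : (1 + v 0) ≠ 0 := by positivity
  have h4 : iMap v ⬝ᵥ iMap v = (v 0 - 1) / (1 + v 0) := by
    simp only [iMap, dotProduct, Fin.sum_univ_three]
    simp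
    field_simp
    nlinarith
  have h5 : 1 - (v 0 - 1) / (1 + v 0) = 2 / (1 + v 0) := by field_simp; ring
  have h6 : 1 + (v 0 - 1) / (1 + v 0) = 2 * v 0 / (1 + v 0) := by field_simp; ring
  simp only [iInv, h4, h5, h6]
  ext k
  fin_cases k <;> simp [iMap] <;> field_simp

theorem jInv_jMap (x : Space) (hx : x ⬝ᵥ x < 1) : jInv (jMap x) = x := by
  simp only [dotProduct, Fin.sum_univ_three] at hx
  have hD : 0 < x 0 ^ 2 + x 1 ^ 2 + (1 - x 2) ^ 2 := by
    have : x 2 < 1 := by nlinarith [sq_nonneg (x 0), sq_nonneg (x 1)]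
    have := sub_pos.2 this
    positivity
  set D := x 0 ^ 2 + x 1 ^ 2 + (1 - x 2) ^ 2 with hDdef
  have h0 : jMap x 0 = 2 * x 0 / D := by simp [jMap, hDdef]
  have h1 : jMap x 1 = 2 * x 1 / D := by simp [jMap, hDdef]
  have h2 : jMap x 2 = (1 - (x 0 * x 0 + x 1 * x 1 + x 2 * x 2)) / D := by
    simp [jMap, hDdef, dotProduct, Fin.sum_univ_three]
  have h2b : jMap x 2 + 1 = 2 * (1 - x 2) / D := by
    rw [h2, div_add_one hD.ne']; congr 1; rw [hDdef]; ring
  have hE : jMap x 0 ^ 2 + jMap x 1 ^ 2 + (jMap x 2 + 1) ^ 2 = 4 / D := by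
    rw [h0, h1, h2b]; field_simp; rw [hDdef]; ring
  have h3 : jMap x ⬝ᵥ jMap x - 1 = 4 * x 2 / D := by
    have : jMap x ⬝ᵥ jMap x - 1 = (jMap x 0 ^ 2 + jMap x 1 ^ 2 + (jMap x 2 + 1) ^ 2)
        - 2 * (jMap x 2 + 1) := by
      simp only [dotProduct, Fin.sum_univ_three]; ring
    rw [this, hE, h2b]; field_simp; ring
  simp only [jInv]
  rw [hE, h3, h0, h1]
  ext k
  fin_cases k <;> simp <;> field_simp <;> ring

/-- The decorated horosphere `K(κ) = J(I(H(G(F(κ)))))` in the upper half space model. -/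
def K (κ : Spinor) : LineFieldOn Space :=
  LineFieldOn.map jMap (LineFieldOn.map iMap (flagH (flagG (flagF κ))))

/-! ### The action of `SL(2, ℂ)` -/

/-- The action of `A` on Minkowski space, `v ↦ g(A g⁻¹(v) A*)`. -/
def actM (A : SL2C) (v : Mink) : Mink :=
  g ⟨A.1 * gInv v * A.1ᴴ, by
    rw [selfAdjoint.mem_iff, star_eq_conjTranspose, conjTranspose_mul, conjTranspose_mul,
      conjTranspose_conjTranspose, ← star_eq_conjTranspose (gInv v),
      selfAdjoint.mem_iff.1 (gInv_isSelfAdjoint v), Matrix.mul_assoc]⟩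

/-- The action of `A` by an isometry of the upper half space. -/
def act (A : SL2C) (x : Space) : Space := jMap (iMap (actM A (iInv (jInv x))))

/-- The derivative of the isometry `act A` at `x`. -/
def dact (A : SL2C) (x : Space) : Space →L[ℝ] Space := fderiv ℝ (act A) x

open Classical in
/-- The action of `A` on the boundary `ℂ ∪ {∞}` by Möbius transformations. -/
def actBoundary (A : SL2C) (z : OnePoint ℂ) : OnePoint ℂ :=
  (Matrix.SpecialLinearGroup.toGL A) • z

/-- The base point `p₀ = (0, 0, 1)` of the upper half space. -/
def basePt : Space := ![0, 0, 1]

/-- The screw motion `(x, y, h) ↦ (e^d (x + y i), e^{Re d} h)`: translation by `Re d` along the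
upward vertical geodesic together with rotation by `Im d` about it. -/
def screw (d : ℂ) (x : Space) : Space :=
  ![(Complex.exp d * (x 0 + x 1 * Complex.I)).re, (Complex.exp d * (x 0 + x 1 * Complex.I)).im,
    Real.exp d.re * x 2]

/-- The oriented geodesic `γ_A`, parametrised by arc length, running from `A • 0` to `A • ∞`: the
image under `A` of the upward vertical geodesic. -/
def geod (A : SL2C) (t : ℝ) : Space := act A ![0, 0, Real.exp t]

/-- `B` is the spin isometry given by translating by `Re d` along `γ_A` and rotating by `Im d`
about it: the end of the path in `SL(2, ℂ)` that starts at the identity and lifts the path of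
isometries which translate by `t Re d` and rotate by `t Im d`, for `t` from `0` to `1`. -/
def IsSpinScrew (A : SL2C) (d : ℂ) (B : SL2C) : Prop :=
  ∃ M : unitInterval → SL2C, Continuous M ∧ M 0 = 1 ∧ M 1 = B ∧
    ∀ (t : unitInterval) (x : Space), 0 < x 2 →
      act (M t) x = act A (screw (((t : ℝ) : ℂ) * d) (act A⁻¹ x))

/-! ### Frames and spin frames

A right-handed orthonormal frame on hyperbolic space consists of a base point and three tangent
vectors there. The group of orientation preserving isometries acts simply transitively on frames,
and its universal (double) cover `SL(2, ℂ)` acts simply transitively on spin frames, so, having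
chosen a lift of the base frame `(e_z, e_y, -e_x)` at `p₀`, we identify the space of spin frames
with `SL(2, ℂ)`. -/

/-- A frame in the upper half space: a point and three tangent vectors. -/
@[ext]
structure Frame where
  pt : Space
  e1 : Space
  e2 : Space
  e3 : Space

/-- The projection from spin frames to frames: the spin frame `A` lies over the image under `A`
of the base frame. -/
def frameOf (A : SL2C) : Frame where
  pt := act A basePt
  e1 := dact A basePt ![0, 0, 1]
  e2 := dact A basePt ![0, 1, 0]
  e3 := dact A basePt ![-1, 0, 0]

/-- `v` is a unit vector at `q` in the hyperbolic metric of the upper half space. -/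
def IsUnitAt (q v : Space) : Prop := v ⬝ᵥ v = (q 2) ^ 2

/-- The cross product of tangent vectors at `q` in the hyperbolic metric. -/
def hcross (q v w : Space) : Space := (q 2)⁻¹ • (v ⨯₃ w)

/-- The spin frame `s'` is obtained from `s` by rotating by the angle `θ` (right-handed) about
the unit vector `v` at `q`. -/
def IsSpinRotation (q v : Space) (θ : ℝ) (s s' : SL2C) : Prop :=
  ∃ A B : SL2C, act A basePt = q ∧ dact A basePt ![0, 0, 1] = v ∧
    IsSpinScrew A (θ * Complex.I) B ∧ s' = B * s

/-! ### Horospheres and spin decorations -/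

/-- A horosphere in the upper half space. -/
structure Horosphere where
  carrier : Set Space
  isHoro : ∃ p ∈ lightCone, carrier = (fun x => jMap (iMap x)) '' horoH p

/-- The point of the light cone representing the horosphere. -/
def Horosphere.cone (h : Horosphere) : Mink := h.isHoro.choose

open Classical in
/-- The point of `ℂ ∪ {∞}` where the ray of the light cone through `p` meets the boundary: the
image of the boundary point `(X, Y, Z) / T` of the ball under `(x + y i) / (1 - z)`. -/
def boundaryPt (p : Mink) : OnePoint ℂ :=
  if p 3 / p 0 = 1 then OnePoint.infty
  else (((((p 1 / p 0 : ℝ) : ℂ) + ((p 2 / p 0 : ℝ) : ℂ) * Complex.I) /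
    (1 - ((p 3 / p 0 : ℝ) : ℂ)) : ℂ) : OnePoint ℂ)

/-- The centre of a horosphere. -/
def Horosphere.centre (h : Horosphere) : OnePoint ℂ := boundaryPt h.cone

/-- The tangent space of the horosphere at `q`. -/
def Horosphere.tangent (h : Horosphere) (q : Space) : Set Space :=
  (fderiv ℝ (fun x => jMap (iMap x)) (iInv (jInv q))) '' horoTangentH h.cone (iInv (jInv q))

/-- `n` is the outward unit normal of `h` at `q`: it is a unit vector, orthogonal to `h`, and the
geodesic from `q` in the direction `n` tends to the centre of `h`. -/
def Horosphere.IsOutwardNormal (h : Horosphere) (q n : Space) : Prop :=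
  IsUnitAt q n ∧ (∀ v ∈ h.tangent q, n ⬝ᵥ v = 0) ∧
    ∃ A : SL2C, act A basePt = q ∧ dact A basePt ![0, 0, 1] = n ∧
      actBoundary A OnePoint.infty = h.centre

/-- `V` is a unit parallel tangent vector field on `h`: it is invariant under all parabolic
isometries (and the identity) preserving `h`. -/
def Horosphere.IsUnitParallel (h : Horosphere) (V : h.carrier → Space) : Prop :=
  (∀ q : h.carrier, V q ∈ h.tangent q ∧ IsUnitAt q (V q)) ∧
  ∀ A : SL2C, (A.1.trace = 2 ∨ A.1.trace = -2) → act A '' h.carrier = h.carrier →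
    ∀ q q' : h.carrier, act A q = q' → V q' = dact A q (V q)

/-- A spin-decorated horosphere: a horosphere with continuous fields `Win`, `Wout` of spin frames
lifting the inward and outward frame fields of a unit parallel vector field `V`, such that
`Win` is obtained from `Wout` by rotating by `π` about `V`. -/
structure SpinDecoratedHorosphere extends Horosphere where
  Win : carrier → SL2C
  Wout : carrier → SL2C
  continuous_Win : Continuous Win
  continuous_Wout : Continuous Wout
  isSpinDecoration : ∃ V : carrier → Space, toHorosphere.IsUnitParallel V ∧
    ∀ q : carrier, ∃ N : Space, toHorosphere.IsOutwardNormal q N ∧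
      frameOf (Wout q) = ⟨q, N, V q, hcross q N (V q)⟩ ∧
      frameOf (Win q) = ⟨q, -N, V q, hcross q (-N) (V q)⟩ ∧
      IsSpinRotation q (V q) Real.pi (Wout q) (Win q)

/-- `Kt` is a continuous lift of `K` to spin-decorated horospheres: `Kt κ` projects to the
decorated horosphere `K κ`, and its spin frames depend continuously on `κ` and on the point of
the horosphere. -/
structure IsSpinLift (Kt : {κ : Spinor // κ ≠ 0} → SpinDecoratedHorosphere) : Prop where
  carrier_eq : ∀ κ, (Kt κ).carrier = (K κ.1).carrier
  dir_eq : ∀ (κ) (q : (Kt κ).carrier) (w : Space), w ∈ (K κ.1).dir q ↔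
    ∃ c : ℝ, 0 < c ∧ w = c • (frameOf ((Kt κ).Wout q)).e2
  continuous_Wout : Continuous
    (fun z : {z : {κ : Spinor // κ ≠ 0} × Space // z.2 ∈ (Kt z.1).carrier} =>
      (Kt z.1.1).Wout ⟨z.1.2, z.2⟩)
  continuous_Win : Continuous
    (fun z : {z : {κ : Spinor // κ ≠ 0} × Space // z.2 ∈ (Kt z.1).carrier} =>
      (Kt z.1.1).Win ⟨z.1.2, z.2⟩)

/-! ### Complex distance and complex lambda length -/

/-- The spin frame `s` is adapted to the oriented geodesic `γ_A`: its base point lies on `γ_A` and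
its first vector is the positive unit tangent of `γ_A`. -/
def IsAdapted (A s : SL2C) : Prop :=
  ∃ t : ℝ, (frameOf s).pt = geod A t ∧ (frameOf s).e1 = deriv (geod A) t

/-- `d` is a complex distance from `s₁` to `s₂`, both adapted to `γ_A`: translating `s₁` along
`γ_A` by `Re d` and rotating about `γ_A` by `Im d` gives `s₂`. It is determined modulo `4πi`. -/
def IsComplexDistance (A s₁ s₂ : SL2C) (d : ℂ) : Prop :=
  IsAdapted A s₁ ∧ IsAdapted A s₂ ∧ ∃ B : SL2C, IsSpinScrew A d B ∧ s₂ = B * s₁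

/-- `l` is the complex lambda length from `H₁` to `H₂`: it is `0` if the centres coincide, and
otherwise `exp(d / 2)`, where `d` is the complex distance from the inward spin frame of `H₁` to
the outward spin frame of `H₂` at the points where the oriented geodesic from the centre of `H₁`
to the centre of `H₂` meets the two horospheres. -/
def IsLambdaLength (H₁ H₂ : SpinDecoratedHorosphere) (l : ℂ) : Prop :=
  (H₁.centre = H₂.centre ∧ l = 0) ∨
  (H₁.centre ≠ H₂.centre ∧ ∃ A : SL2C,
    actBoundary A ((0 : ℂ) : OnePoint ℂ) = H₁.centre ∧ actBoundary A OnePoint.infty = H₂.centre ∧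
    ∃ (q₁ : H₁.carrier) (q₂ : H₂.carrier), (q₁ : Space) ∈ Set.range (geod A) ∧
      (q₂ : Space) ∈ Set.range (geod A) ∧
      ∃ d : ℂ, IsComplexDistance A (H₁.Win q₁) (H₂.Wout q₂) d ∧ l = Complex.exp (d / 2))

end

end SpinHoro

namespace SpinHoro

noncomputable section

/-! Once spin frames are identified with `SL(2, ℂ)`, every geometric object in the statement becomes
a condition on the columns of a matrix. The stabiliser of the base point `p₀` is `SU(2)`, so the
horosphere of `κ` is the set of points `W p₀` with `W` of first column `κ`, and each point comes
from exactly one such `W` (`mem_K_carrier`, `eq_of_col_eq`). At `W p₀` the normal towards the centre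
is the image of `e_z` and the flag direction is the image of `e_y`
(`Horosphere.isOutwardNormal_iff`, `mem_K_dir`). Hence the outward spin frame is `±W`, and the
inward one is `±W * halfTurn` with the same sign, because rotation by `π` about the flag direction
is conjugate by `W` to `halfTurn` (`isSpinRotation_iff`).

The choice of sign `+` everywhere is continuous, because the second column of `W` is a continuous
function of `κ` and the point; this gives existence. Conversely, the pairs of a nonzero spinor and a
point of its horosphere are parametrised by the connected space `(ℂ² ∖ 0) × ℂ`, so any lift has a
single global sign (`IsSpinLift.exists_sign`).

Spin frames adapted to `γ_A` are exactly the `A * dg v`, and a screw motion by `d` along `γ_A`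
multiplies `v` by `exp (d / 2)` (`isComplexDistance_iff`). If `W₁ * halfTurn = A * dg v₁` and `W₂ =
A * dg v₂`, then comparison of the second columns in the former and of the first columns in the
latter, with `A₁, A₂` the columns of `A`, gives `κ₁ = -v₁⁻¹ A₂` and `κ₂ = v₂ A₁`. So `{κ₁, κ₂} = (v₂
/ v₁) det A = exp (d / 2)`. The global sign occurs in both frames and cancels. -/

/-- The base point of the hyperboloid. -/
def hypBase : Mink := ![1, 0, 0, 0]

/-- The isometry from the hyperboloid to the upper half space. -/
def toU (v : Mink) : Space := jMap (iMap v)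

/-- The isometry from the upper half space to the hyperboloid. -/
def fromU (x : Space) : Mink := iInv (jInv x)

/-! ### The linear action of `SL(2, ℂ)` on Minkowski space -/

theorem val_mul (A B : SL2C) : (A * B).1 = A.1 * B.1 := rfl

theorem val_one : (1 : SL2C).1 = 1 := rfl

theorem val_neg (A : SL2C) : (-A).1 = -A.1 := rfl

theorem val_inv (A : SL2C) : (A⁻¹).1 = !![A.1 1 1, -A.1 0 1; -A.1 1 0, A.1 0 0] :=
  adjugate_fin_two A.1

theorem det_eq (A : SL2C) : A.1 0 0 * A.1 1 1 - A.1 0 1 * A.1 1 0 = 1 := by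
  rw [← det_fin_two]; exact A.2

theorem SL2C_ext {A B : SL2C} (h00 : A.1 0 0 = B.1 0 0) (h01 : A.1 0 1 = B.1 0 1)
    (h10 : A.1 1 0 = B.1 1 0) (h11 : A.1 1 1 = B.1 1 1) : A = B :=
  Subtype.ext (by ext i j; fin_cases i <;> fin_cases j <;> assumption)

theorem act_eq (A : SL2C) (x : Space) : act A x = toU (actM A (fromU x)) := rfl

theorem gInv_injective : Function.Injective gInv := fun v w h => by
  rw [← g_gInv v, ← g_gInv w]; congr 2

theorem gInv_actM (A : SL2C) (v : Mink) : gInv (actM A v) = A.1 * gInv v * A.1ᴴ := by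
  rw [actM, gInv_g]

theorem actM_mul (A B : SL2C) (v : Mink) : actM (A * B) v = actM A (actM B v) :=
  gInv_injective (by
    simp only [gInv_actM, val_mul, conjTranspose_mul, Matrix.mul_assoc])

theorem actM_one (v : Mink) : actM 1 v = v := gInv_injective (by simp [gInv_actM])

theorem actM_actM_inv (A : SL2C) (v : Mink) : actM A (actM A⁻¹ v) = v := by
  rw [← actM_mul, mul_inv_cancel, actM_one]

theorem gInv_add (v w : Mink) : gInv (v + w) = gInv v + gInv w := by
  ext i j; fin_cases i <;> fin_cases j <;> simp [gInv] <;> ring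

theorem gInv_smul (c : ℝ) (v : Mink) : gInv (c • v) = (c : ℂ) • gInv v := by
  ext i j; fin_cases i <;> fin_cases j <;> simp [gInv] <;> ring

/-- The action on Minkowski space as a linear map. -/
def actMLin (A : SL2C) : Mink →L[ℝ] Mink :=
  LinearMap.toContinuousLinearMap
    { toFun := actM A
      map_add' := fun v w => gInv_injective (by
        simp only [gInv_actM, gInv_add, Matrix.mul_add, Matrix.add_mul])
      map_smul' := fun c v => gInv_injective (by
        simp only [gInv_actM, gInv_smul, Matrix.mul_smul, Matrix.smul_mul, RingHom.id_apply]) }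

theorem actMLin_apply (A : SL2C) (v : Mink) : actMLin A v = actM A v := rfl

theorem actM_add (A : SL2C) (v w : Mink) : actM A (v + w) = actM A v + actM A w :=
  map_add (actMLin A) v w

theorem actM_smul (A : SL2C) (c : ℝ) (v : Mink) : actM A (c • v) = c • actM A v :=
  map_smul (actMLin A) c v

/-- The Minkowski norm is a determinant of Hermitian matrices, so its invariance is multiplicativity
of `det`; polarisation then extends this to the bilinear form. -/
theorem mform_self (v : Mink) : (mform v v : ℂ) = 4 * (gInv v).det := by
  simp only [mform, gInv, det_fin_two_of]
  push_cast
  linear_combination (-(v 2 : ℂ) ^ 2) * Complex.I_sq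

theorem mform_actM_self (A : SL2C) (v : Mink) : mform (actM A v) (actM A v) = mform v v := by
  have h : (mform (actM A v) (actM A v) : ℂ) = mform v v := by
    rw [mform_self, mform_self, gInv_actM, det_mul, det_mul, det_conjTranspose, A.2]; simp
  exact_mod_cast h

theorem mform_polar (v w : Mink) : 2 * mform v w = mform (v + w) (v + w) - mform v v - mform w w := by
  simp only [mform, Pi.add_apply]; ring

theorem mform_actM (A : SL2C) (v w : Mink) : mform (actM A v) (actM A w) = mform v w := by
  have h := mform_polar (actM A v) (actM A w)
  rw [← actM_add, mform_actM_self, mform_actM_self, mform_actM_self, ← mform_polar] at h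
  linarith

theorem mform_smul_right (c : ℝ) (v w : Mink) : mform v (c • w) = c * mform v w := by
  simp only [mform, Pi.smul_apply, smul_eq_mul]; ring

theorem mform_add_right (u v w : Mink) : mform u (v + w) = mform u v + mform u w := by
  simp only [mform, Pi.add_apply]; ring

/-- The matrix with columns `(v, 0)` and `(0, v⁻¹)`. -/
def dg (v : ℂˣ) : SL2C := ⟨!![(v : ℂ), 0; 0, (v⁻¹ : ℂˣ)], by simp [det_fin_two_of]⟩

/-- The upper unipotent matrix of `w`. -/
def uni (w : ℂ) : SL2C := ⟨!![1, w; 0, 1], by simp [det_fin_two_of]⟩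

theorem val_dg (v : ℂˣ) : (dg v).1 = !![(v : ℂ), 0; 0, (v : ℂ)⁻¹] := by simp [dg]

theorem val_uni (w : ℂ) : (uni w).1 = !![1, w; 0, 1] := rfl

theorem gInv_hypBase : gInv hypBase = (1 / 2 : ℂ) • (1 : Matrix (Fin 2) (Fin 2) ℂ) := by
  ext i j; fin_cases i <;> fin_cases j <;> simp [gInv, hypBase]

theorem gInv_actM_hypBase (A : SL2C) : gInv (actM A hypBase) = (1 / 2 : ℂ) • (A.1 * A.1ᴴ) := by
  rw [gInv_actM, gInv_hypBase]; simp

theorem mul_conjTranspose_apply (M : Matrix (Fin 2) (Fin 2) ℂ) (i j : Fin 2) :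
    (M * Mᴴ) i j = M i 0 * star (M j 0) + M i 1 * star (M j 1) := by
  simp only [Matrix.mul_apply, Fin.sum_univ_two, conjTranspose_apply]

theorem val_uni_mul_dg (w : ℂ) (s : ℂˣ) :
    (uni w * dg s).1 = !![(s : ℂ), w * (s : ℂ)⁻¹; 0, (s : ℂ)⁻¹] := by
  rw [val_mul, val_uni, val_dg]; simp

theorem mk0_ne {x : ℝ} (hx : 0 < x) : ((x : ℝ) : ℂ) ≠ 0 := by exact_mod_cast hx.ne'

/-- The upper triangular group acts transitively on the hyperboloid. -/
theorem exists_uni_dg {v : Mink} (hv : v ∈ hyperboloid) :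
    ∃ (w : ℂ) (s : ℂˣ), (s : ℂ) = ((Real.sqrt (v 0 - v 3))⁻¹ : ℝ) ∧
      v = actM (uni w * dg s) hypBase := by
  obtain ⟨h1, h2⟩ := hv
  simp only [mform] at h1
  have hn : 0 < v 0 - v 3 := by
    have : v 3 < v 0 := by nlinarith [sq_nonneg (v 1), sq_nonneg (v 2)]
    linarith
  have hs := Real.sqrt_pos.2 hn
  set r := Real.sqrt (v 0 - v 3) with hr
  have hrr : r * r = v 0 - v 3 := Real.mul_self_sqrt hn.le
  have hrc : (r : ℂ) ≠ 0 := mk0_ne hs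
  have hrr' : (r : ℂ) * r = v 0 - v 3 := by exact_mod_cast hrr
  have h1' : (v 0 : ℂ) * v 0 - v 1 * v 1 - v 2 * v 2 - v 3 * v 3 = 1 := by exact_mod_cast h1
  have hnc : (v 0 : ℂ) - v 3 ≠ 0 := by rw [← hrr']; exact mul_ne_zero hrc hrc
  -- These are upper half space coordinates: `w` is the horizontal position `(X + iY) / (T - Z)` and
  -- `s²` is the height `1 / (T - Z)`.
  refine ⟨(v 1 + v 2 * Complex.I) / (v 0 - v 3 : ℂ), Units.mk0 ((r⁻¹ : ℝ) : ℂ)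
    (mk0_ne (inv_pos.2 hs)), rfl, gInv_injective ?_⟩
  rw [gInv_actM_hypBase, val_uni_mul_dg]
  ext i j
  rw [Matrix.smul_apply, mul_conjTranspose_apply]
  fin_cases i <;> fin_cases j <;>
    simp [gInv] <;> rw [← hrr'] <;> field_simp
  · linear_combination ((v 0 : ℂ) + v 3) * hrr' + h1' + v 2 ^ 2 * Complex.I_sq
  · ring

theorem hypBase_mem : hypBase ∈ hyperboloid := by simp [hyperboloid, hypBase, mform]

theorem two_mul_gInv_zero (v : Mink) : (v 0 : ℂ) = gInv v 0 0 + gInv v 1 1 := by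
  simp [gInv]; ring

theorem gInv_one_one (v : Mink) : ((v 0 - v 3 : ℝ) : ℂ) = 2 * gInv v 1 1 := by
  simp [gInv]; ring

theorem gInv_zero_one (v : Mink) : (v 1 : ℂ) + v 2 * Complex.I = 2 * gInv v 0 1 := by
  simp [gInv]; ring

theorem actM_hypBase_mem (A : SL2C) : actM A hypBase ∈ hyperboloid := by
  refine ⟨by rw [mform_actM]; exact hypBase_mem.1, ?_⟩
  -- The time coordinate is half the sum of the squared moduli of the entries, which cannot vanish
  -- for an invertible matrix.
  have h : (actM A hypBase 0 : ℂ) = ((1 / 2 * (Complex.normSq (A.1 0 0) + Complex.normSq (A.1 0 1)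
      + Complex.normSq (A.1 1 0) + Complex.normSq (A.1 1 1)) : ℝ) : ℂ) := by
    rw [two_mul_gInv_zero, gInv_actM_hypBase]
    simp [Matrix.mul_apply, Fin.sum_univ_two, conjTranspose_apply, Complex.mul_conj]; ring
  rw [Complex.ofReal_inj.1 h]
  have hdet := A.2
  rw [det_fin_two] at hdet
  have h00 := Complex.normSq_nonneg (A.1 0 0)
  have h01 := Complex.normSq_nonneg (A.1 0 1)
  have h10 := Complex.normSq_nonneg (A.1 1 0)
  have h11 := Complex.normSq_nonneg (A.1 1 1)
  by_contra hc
  have e00 : A.1 0 0 = 0 := Complex.normSq_eq_zero.1 (by linarith)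
  have e01 : A.1 0 1 = 0 := Complex.normSq_eq_zero.1 (by linarith)
  simp [e00, e01] at hdet

theorem actM_mem {A : SL2C} {v : Mink} (hv : v ∈ hyperboloid) : actM A v ∈ hyperboloid := by
  obtain ⟨w, s, -, rfl⟩ := exists_uni_dg hv
  rw [← actM_mul]; exact actM_hypBase_mem _

/-! ### The upper half space -/

theorem sub_pos_of_mem {v : Mink} (hv : v ∈ hyperboloid) : 0 < v 0 - v 3 := by
  obtain ⟨h1, h2⟩ := hv
  simp only [mform] at h1
  have : v 3 < v 0 := by nlinarith [sq_nonneg (v 1), sq_nonneg (v 2)]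
  linarith

/-- Valid on an open subset of Minkowski space, not only on the hyperboloid, because the derivatives
of `toU` are taken in the ambient space. -/
theorem toU_apply {v : Mink} (hv : 0 < v 0) : toU v =
    ![2 * v 1 * (1 + v 0) / (v 1 ^ 2 + v 2 ^ 2 + (1 + v 0 - v 3) ^ 2),
      2 * v 2 * (1 + v 0) / (v 1 ^ 2 + v 2 ^ 2 + (1 + v 0 - v 3) ^ 2),
      ((1 + v 0) ^ 2 - v 1 ^ 2 - v 2 ^ 2 - v 3 ^ 2) /
        (v 1 ^ 2 + v 2 ^ 2 + (1 + v 0 - v 3) ^ 2)] := by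
  have h : 1 + v 0 ≠ 0 := by positivity
  have hD : (v 1 / (1 + v 0)) ^ 2 + (v 2 / (1 + v 0)) ^ 2 + (1 - v 3 / (1 + v 0)) ^ 2 =
      (v 1 ^ 2 + v 2 ^ 2 + (1 + v 0 - v 3) ^ 2) / (1 + v 0) ^ 2 := by field_simp
  have hN : 1 - (v 1 / (1 + v 0) * (v 1 / (1 + v 0)) + v 2 / (1 + v 0) * (v 2 / (1 + v 0)) +
      v 3 / (1 + v 0) * (v 3 / (1 + v 0))) =
      ((1 + v 0) ^ 2 - v 1 ^ 2 - v 2 ^ 2 - v 3 ^ 2) / (1 + v 0) ^ 2 := by field_simp; ring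
  ext k
  fin_cases k <;>
    simp only [toU, jMap, iMap, dotProduct, Fin.sum_univ_three, Fin.zero_eta, Fin.mk_one,
      Fin.reduceFinMk, cons_val_zero, cons_val_one, cons_val]
  · rw [hD]; field_simp
  · rw [hD]; field_simp
  · rw [hD, hN]; field_simp

/-- On the hyperboloid the common factor `2 (1 + T)` cancels, which leaves horospherical
coordinates. -/
theorem toU_of_mem {v : Mink} (hv : v ∈ hyperboloid) :
    toU v = ![v 1 / (v 0 - v 3), v 2 / (v 0 - v 3), 1 / (v 0 - v 3)] := by
  have hn := (sub_pos_of_mem hv).ne'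
  have h0 : 1 + v 0 ≠ 0 := by have := hv.2; positivity
  have h1 : v 0 * v 0 - v 1 * v 1 - v 2 * v 2 - v 3 * v 3 = 1 := hv.1
  rw [toU_apply hv.2, show v 1 ^ 2 + v 2 ^ 2 + (1 + v 0 - v 3) ^ 2 = 2 * (1 + v 0) * (v 0 - v 3) by
    linear_combination -h1, show (1 + v 0) ^ 2 - v 1 ^ 2 - v 2 ^ 2 - v 3 ^ 2 = 2 * (1 + v 0) by
    linear_combination h1]
  ext k
  fin_cases k <;> simp <;> field_simp

theorem fromU_apply {x : Space} (hx : 0 < x 2) : fromU x =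
    ![(1 + x 0 ^ 2 + x 1 ^ 2 + x 2 ^ 2) / (2 * x 2), x 0 / x 2, x 1 / x 2,
      (x 0 ^ 2 + x 1 ^ 2 + x 2 ^ 2 - 1) / (2 * x 2)] := by
  have hD : x 0 ^ 2 + x 1 ^ 2 + (x 2 + 1) ^ 2 ≠ 0 := by positivity
  set D := x 0 ^ 2 + x 1 ^ 2 + (x 2 + 1) ^ 2 with hDdef
  have hS : jInv x ⬝ᵥ jInv x = 1 - 4 * x 2 / D := by
    simp only [jInv, ← hDdef, dotProduct, Fin.sum_univ_three, cons_val_zero, cons_val_one, cons_val]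
    field_simp
    rw [hDdef]; ring
  ext k
  fin_cases k <;> simp only [fromU, iInv, hS, Fin.zero_eta, Fin.mk_one, Fin.reduceFinMk,
      cons_val_zero, cons_val_one, cons_val] <;>
    (try simp only [jInv, ← hDdef, dotProduct, Fin.sum_univ_three,
      cons_val_zero, cons_val_one, cons_val]) <;>
    rw [show 1 - (1 - 4 * x 2 / D) = 4 * x 2 / D by ring] <;> field_simp <;>
    (try rw [hDdef]) <;> ring

theorem fromU_mem {x : Space} (hx : 0 < x 2) : fromU x ∈ hyperboloid := by
  rw [fromU_apply hx]
  refine ⟨?_, ?_⟩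
  · simp [mform]; field_simp; ring
  · simp; positivity

theorem toU_fromU {x : Space} (hx : 0 < x 2) : toU (fromU x) = x := by
  rw [toU_of_mem (fromU_mem hx), fromU_apply hx]
  ext k
  fin_cases k <;> simp <;> field_simp <;> ring

theorem fromU_toU {v : Mink} (hv : v ∈ hyperboloid) : fromU (toU v) = v := by
  have h : iMap v ⬝ᵥ iMap v < 1 := by
    have h1 : v 0 * v 0 - v 1 * v 1 - v 2 * v 2 - v 3 * v 3 = 1 := hv.1
    have h2 := hv.2
    simp only [iMap, dotProduct, Fin.sum_univ_three, cons_val_zero, cons_val_one, cons_val]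
    rw [div_mul_div_comm, div_mul_div_comm, div_mul_div_comm, ← add_div, ← add_div,
      div_lt_one (by positivity)]
    nlinarith
  rw [fromU, toU, jInv_jMap _ h, iInv_iMap _ hv]

theorem toU_pos {v : Mink} (hv : v ∈ hyperboloid) : 0 < toU v 2 := by
  rw [toU_of_mem hv]; simpa using sub_pos_of_mem hv

theorem toU_injOn : Set.InjOn toU hyperboloid := fun v hv w hw h => by
  rw [← fromU_toU hv, h, fromU_toU hw]

theorem act_pos (A : SL2C) {x : Space} (hx : 0 < x 2) : 0 < act A x 2 :=
  toU_pos (actM_mem (fromU_mem hx))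

theorem act_mul (A B : SL2C) {x : Space} (hx : 0 < x 2) : act (A * B) x = act A (act B x) := by
  rw [act_eq, act_eq A, act_eq B, fromU_toU (actM_mem (fromU_mem hx)), actM_mul]

theorem act_one {x : Space} (hx : 0 < x 2) : act 1 x = x := by
  rw [act_eq, actM_one, toU_fromU hx]

theorem basePt_pos : 0 < basePt 2 := by simp [basePt]

theorem toU_hypBase : toU hypBase = basePt := by
  rw [toU_of_mem hypBase_mem]; ext k; fin_cases k <;> simp [hypBase, basePt]

theorem fromU_basePt : fromU basePt = hypBase := by rw [← toU_hypBase, fromU_toU hypBase_mem]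

theorem act_basePt (A : SL2C) : act A basePt = toU (actM A hypBase) := by
  rw [act_eq, fromU_basePt]

theorem act_basePt_pos (A : SL2C) : 0 < act A basePt 2 := act_pos A basePt_pos

/-- The base point corresponds to half the identity matrix, so its image under `A` is encoded by `A
A*`; in particular its stabiliser is `SU(2)`. -/
theorem act_basePt_eq_iff {A B : SL2C} :
    act A basePt = act B basePt ↔ A.1 * A.1ᴴ = B.1 * B.1ᴴ := by
  rw [act_basePt, act_basePt, toU_injOn.eq_iff (actM_hypBase_mem A) (actM_hypBase_mem B),
    ← gInv_injective.eq_iff, gInv_actM_hypBase, gInv_actM_hypBase]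
  exact (IsUnit.mk0 (1 / 2 : ℂ) (by norm_num)).smul_left_cancel

/-! ### Derivatives of the isometries -/

theorem differentiableAt_toU {v : Mink} (hv : v ∈ hyperboloid) : DifferentiableAt ℝ toU v := by
  have h0 := hv.2
  have hE : v 1 ^ 2 + v 2 ^ 2 + (1 + v 0 - v 3) ^ 2 ≠ 0 := by
    have := sub_pos_of_mem hv
    have : 0 < 1 + v 0 - v 3 := by linarith
    positivity
  have hev : toU =ᶠ[nhds v] fun v =>
      ![2 * v 1 * (1 + v 0) / (v 1 ^ 2 + v 2 ^ 2 + (1 + v 0 - v 3) ^ 2),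
      2 * v 2 * (1 + v 0) / (v 1 ^ 2 + v 2 ^ 2 + (1 + v 0 - v 3) ^ 2),
      ((1 + v 0) ^ 2 - v 1 ^ 2 - v 2 ^ 2 - v 3 ^ 2) /
        (v 1 ^ 2 + v 2 ^ 2 + (1 + v 0 - v 3) ^ 2)] := by
    filter_upwards [(isOpen_lt continuous_const (continuous_apply (0 : Fin 4))).mem_nhds h0]
      with w hw using toU_apply hw
  refine DifferentiableAt.congr_of_eventuallyEq ?_ hev
  rw [differentiableAt_pi]
  intro i
  fin_cases i <;> simp <;> fun_prop (disch := exact hE)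

theorem hasDerivAt_line {ι : Type} [Fintype ι] (v u : ι → ℝ) (i : ι) :
    HasDerivAt (fun t : ℝ => (v + t • u) i) (u i) 0 := by
  simpa using ((hasDerivAt_id (0 : ℝ)).mul_const (u i)).const_add (v i)

theorem fderiv_apply_eq {ι κ : Type} [Fintype ι] [Fintype κ] {φ : (ι → ℝ) → (κ → ℝ)} {v u : ι → ℝ}
    {d : κ → ℝ} (hφ : DifferentiableAt ℝ φ v)
    (h : ∀ k, HasDerivAt (fun t : ℝ => φ (v + t • u) k) (d k) 0) : fderiv ℝ φ v u = d := by
  have h1 : HasDerivAt (fun t : ℝ => φ (v + t • u)) (fderiv ℝ φ v u) 0 := by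
    have h2 : HasFDerivAt φ (fderiv ℝ φ v) (v + (0 : ℝ) • u) := by simpa using hφ.hasFDerivAt
    have h3 : HasDerivAt (fun t : ℝ => v + t • u) u 0 := by
      simpa using ((hasDerivAt_id (0 : ℝ)).smul_const u).const_add v
    exact h2.comp_hasDerivAt 0 h3
  exact h1.unique (hasDerivAt_pi.2 h)

/-- The derivative of `toU` on tangent vectors of the hyperboloid. -/
theorem fderiv_toU {v u : Mink} (hv : v ∈ hyperboloid) (hu : mform v u = 0) :
    fderiv ℝ toU v u = ![(u 1 * (v 0 - v 3) - v 1 * (u 0 - u 3)) / (v 0 - v 3) ^ 2,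
      (u 2 * (v 0 - v 3) - v 2 * (u 0 - u 3)) / (v 0 - v 3) ^ 2,
      -(u 0 - u 3) / (v 0 - v 3) ^ 2] := by
  have h0 := hv.2
  have hn := sub_pos_of_mem hv
  have hE' : v 1 ^ 2 + v 2 ^ 2 + (1 + v 0 - v 3) ^ 2 = 2 * (1 + v 0) * (v 0 - v 3) := by
    have := hv.1
    simp only [mform] at this
    linear_combination -this
  have hE : v 1 ^ 2 + v 2 ^ 2 + (1 + v 0 - v 3) ^ 2 ≠ 0 := by rw [hE']; positivity
  have hN : (1 + v 0) ^ 2 - v 1 ^ 2 - v 2 ^ 2 - v 3 ^ 2 = 2 * (1 + v 0) := by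
    have := hv.1
    simp only [mform] at this
    linear_combination this
  -- Tangency of `u` is what makes the derivative of the ambient formula agree with that of the
  -- short formula on the hyperboloid.
  have hu' : v 1 * u 1 + v 2 * u 2 = v 0 * u 0 - v 3 * u 3 := by
    simp only [mform] at hu
    linear_combination -hu
  have hev : ∀ᶠ t : ℝ in nhds 0, 0 < (v + t • u) 0 :=
    (hasDerivAt_line v u 0).continuousAt.eventually_mem
      ((isOpen_Ioi (a := (0 : ℝ))).mem_nhds (by simpa using h0))
  have d0 := hasDerivAt_line v u 0
  have d1 := hasDerivAt_line v u 1
  have d2 := hasDerivAt_line v u 2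
  have d3 := hasDerivAt_line v u 3
  have dE := ((d1.fun_pow 2).fun_add (d2.fun_pow 2)).fun_add (((d0.const_add 1).fun_sub d3).fun_pow 2)
  have hne : 1 + v 0 ≠ 0 := by positivity
  have hnn := hn.ne'
  have hE0 : (v + (0 : ℝ) • u) 1 ^ 2 + (v + (0 : ℝ) • u) 2 ^ 2 +
      (1 + (v + (0 : ℝ) • u) 0 - (v + (0 : ℝ) • u) 3) ^ 2 ≠ 0 := by simpa using hE
  refine fderiv_apply_eq (differentiableAt_toU hv) fun k => ?_
  fin_cases k
  · refine (((d1.const_mul 2).fun_mul (d0.const_add 1)).fun_div dE hE0).congr_deriv ?_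
      |>.congr_of_eventuallyEq (by filter_upwards [hev] with t ht; rw [toU_apply ht]; rfl)
    simp
    rw [hE']
    field_simp
    linear_combination -(v 1) * hu'
  · refine (((d2.const_mul 2).fun_mul (d0.const_add 1)).fun_div dE hE0).congr_deriv ?_
      |>.congr_of_eventuallyEq (by filter_upwards [hev] with t ht; rw [toU_apply ht]; rfl)
    simp
    rw [hE']
    field_simp
    linear_combination -(v 2) * hu'
  · refine ((((((d0.const_add 1).fun_pow 2).fun_sub (d1.fun_pow 2)).fun_sub (d2.fun_pow 2)).fun_sub
      (d3.fun_pow 2)).fun_div dE hE0).congr_deriv ?_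
      |>.congr_of_eventuallyEq (by filter_upwards [hev] with t ht; rw [toU_apply ht]; rfl)
    simp
    rw [hE', hN]
    field_simp
    linear_combination (v 3 - v 0 - 1) * hu'

theorem differentiableAt_fromU {x : Space} (hx : 0 < x 2) : DifferentiableAt ℝ fromU x := by
  have hne := hx.ne'
  have hev : fromU =ᶠ[nhds x] fun x =>
      ![(1 + x 0 ^ 2 + x 1 ^ 2 + x 2 ^ 2) / (2 * x 2), x 0 / x 2, x 1 / x 2,
      (x 0 ^ 2 + x 1 ^ 2 + x 2 ^ 2 - 1) / (2 * x 2)] := by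
    filter_upwards [(isOpen_lt continuous_const (continuous_apply (2 : Fin 3))).mem_nhds hx]
      with w hw using fromU_apply hw
  refine DifferentiableAt.congr_of_eventuallyEq ?_ hev
  rw [differentiableAt_pi]
  intro i
  fin_cases i <;> simp <;> fun_prop (disch := simpa using hne)

/-- The horizontal inclusion of tangent vectors at the base point. -/
def tangentBase (u : Space) : Mink := ![0, u 0, u 1, u 2]

theorem fderiv_fromU_basePt (u : Space) : fderiv ℝ fromU basePt u = tangentBase u := by
  have d0 := hasDerivAt_line basePt u 0
  have d1 := hasDerivAt_line basePt u 1
  have d2 := hasDerivAt_line basePt u 2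
  have hev : ∀ᶠ t : ℝ in nhds 0, 0 < (basePt + t • u) 2 :=
    d2.continuousAt.eventually_mem
      ((isOpen_Ioi (a := (0 : ℝ))).mem_nhds (by simp [basePt]))
  have hne : (basePt + (0 : ℝ) • u) 2 ≠ 0 := by simp [basePt]
  have hne' : 2 * (basePt + (0 : ℝ) • u) 2 ≠ 0 := by simp [basePt]
  refine fderiv_apply_eq (differentiableAt_fromU basePt_pos) fun k => ?_
  fin_cases k
  · refine ((((((d0.fun_pow 2).const_add 1).fun_add (d1.fun_pow 2)).fun_add (d2.fun_pow 2)).fun_div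
      (d2.const_mul 2) hne').congr_deriv ?_).congr_of_eventuallyEq
      (by filter_upwards [hev] with t ht; rw [fromU_apply ht]; rfl)
    simp [basePt, tangentBase]; try ring
  · refine ((d0.fun_div d2 hne).congr_deriv ?_).congr_of_eventuallyEq
      (by filter_upwards [hev] with t ht; rw [fromU_apply ht]; rfl)
    simp [basePt, tangentBase]
  · refine ((d1.fun_div d2 hne).congr_deriv ?_).congr_of_eventuallyEq
      (by filter_upwards [hev] with t ht; rw [fromU_apply ht]; rfl)
    simp [basePt, tangentBase]
  · refine ((((((d0.fun_pow 2).fun_add (d1.fun_pow 2)).fun_add (d2.fun_pow 2)).sub_const 1).fun_div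
      (d2.const_mul 2) hne').congr_deriv ?_).congr_of_eventuallyEq
      (by filter_upwards [hev] with t ht; rw [fromU_apply ht]; rfl)
    simp [basePt, tangentBase]; try ring

theorem hasFDerivAt_act (A : SL2C) {x : Space} (hx : 0 < x 2) :
    HasFDerivAt (act A) (((fderiv ℝ toU (actM A (fromU x))).comp (actMLin A)).comp
      (fderiv ℝ fromU x)) x := by
  have h1 := (differentiableAt_fromU hx).hasFDerivAt
  have h2 : HasFDerivAt (actMLin A) (actMLin A) (fromU x) := (actMLin A).hasFDerivAt
  have h3 : HasFDerivAt toU _ (actMLin A (fromU x)) :=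
    (differentiableAt_toU (actM_mem (A := A) (fromU_mem hx))).hasFDerivAt
  exact (h3.comp (fromU x) h2).comp x h1

theorem differentiableAt_act (A : SL2C) {x : Space} (hx : 0 < x 2) :
    DifferentiableAt ℝ (act A) x := (hasFDerivAt_act A hx).differentiableAt

theorem eventually_pos {x : Space} (hx : 0 < x 2) : ∀ᶠ y : Space in nhds x, 0 < y 2 :=
  (isOpen_lt continuous_const (continuous_apply (2 : Fin 3))).mem_nhds hx

theorem dact_mul (A B : SL2C) {x : Space} (hx : 0 < x 2) (u : Space) :
    dact (A * B) x u = dact A (act B x) (dact B x u) := by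
  have h0 : act (A * B) =ᶠ[nhds x] act A ∘ act B := by
    filter_upwards [eventually_pos hx] with y hy using act_mul A B hy
  have h := ((differentiableAt_act A (act_pos B hx)).hasFDerivAt.comp x
    (differentiableAt_act B hx).hasFDerivAt).congr_of_eventuallyEq h0
  rw [dact, h.fderiv]; rfl

theorem dact_eq_of_eventuallyEq {A : SL2C} {x : Space} {φ : Space → Space}
    {φ' : Space →L[ℝ] Space} (h : HasFDerivAt φ φ' x) (hφ : ∀ y : Space, 0 < y 2 → act A y = φ y)
    (hx : 0 < x 2) : dact A x = φ' := by
  have h0 : act A =ᶠ[nhds x] φ := by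
    filter_upwards [eventually_pos hx] with y hy using hφ y hy
  exact (h.congr_of_eventuallyEq h0).fderiv

theorem dact_one {x : Space} (hx : 0 < x 2) (u : Space) : dact 1 x u = u := by
  rw [dact_eq_of_eventuallyEq (hasFDerivAt_id x) (fun y hy => act_one hy) hx]; rfl

theorem dact_basePt (A : SL2C) (u : Space) :
    dact A basePt u = fderiv ℝ toU (actM A hypBase) (actM A (tangentBase u)) := by
  rw [dact, (hasFDerivAt_act A basePt_pos).fderiv, fromU_basePt]
  simp only [ContinuousLinearMap.comp_apply, fderiv_fromU_basePt, actMLin_apply]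

theorem mform_hypBase_tangentBase (u : Space) : mform hypBase (tangentBase u) = 0 := by
  simp [mform, hypBase, tangentBase]

theorem dact_basePt_injective (A : SL2C) : Function.Injective (dact A basePt) := by
  intro u v h
  have h2 := congrArg (dact A⁻¹ (act A basePt)) h
  rwa [← dact_mul _ _ basePt_pos, ← dact_mul _ _ basePt_pos, inv_mul_cancel,
    dact_one basePt_pos, dact_one basePt_pos] at h2

/-- The denominator `|c|² + |d|²`. -/
def den (A : SL2C) : ℝ := Complex.normSq (A.1 1 0) + Complex.normSq (A.1 1 1)

theorem actM_hypBase_sub (A : SL2C) : actM A hypBase 0 - actM A hypBase 3 = den A := by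
  have h := gInv_one_one (actM A hypBase)
  rw [gInv_actM_hypBase, Matrix.smul_apply, mul_conjTranspose_apply] at h
  apply Complex.ofReal_injective
  rw [h, den]
  simp [Complex.mul_conj]

theorem den_pos (A : SL2C) : 0 < den A := by
  rw [← actM_hypBase_sub]; exact sub_pos_of_mem (actM_hypBase_mem A)

theorem act_basePt_two (A : SL2C) : act A basePt 2 = (den A)⁻¹ := by
  rw [act_basePt, toU_of_mem (actM_hypBase_mem A), actM_hypBase_sub]; simp

theorem gInv_tangentBase (u : Space) : gInv (tangentBase u) =
    (1 / 2 : ℂ) • !![(u 2 : ℂ), u 0 + u 1 * Complex.I; u 0 - u 1 * Complex.I, -(u 2 : ℂ)] := by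
  ext i j; fin_cases i <;> fin_cases j <;> simp [gInv, tangentBase] <;> ring

theorem conj_apply_two (A M : Matrix (Fin 2) (Fin 2) ℂ) (i j : Fin 2) :
    (A * M * Aᴴ) i j = (A i 0 * M 0 0 + A i 1 * M 1 0) * star (A j 0) +
      (A i 0 * M 0 1 + A i 1 * M 1 1) * star (A j 1) := by
  simp only [Matrix.mul_apply, Fin.sum_univ_two, conjTranspose_apply]

/-- The derivative at the base point of the isometry of the upper half space. -/
theorem dact_basePt_two (A : SL2C) (u : Space) : (dact A basePt u 2 : ℂ) =
    ((A.1 1 1 * star (A.1 1 1) - A.1 1 0 * star (A.1 1 0)) * u 2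
      - A.1 1 0 * star (A.1 1 1) * (u 0 + u 1 * Complex.I)
      - star (A.1 1 0) * A.1 1 1 * (u 0 - u 1 * Complex.I)) / (den A : ℂ) ^ 2 := by
  have h := gInv_one_one (actM A (tangentBase u))
  rw [gInv_actM, gInv_tangentBase, conj_apply_two] at h
  rw [dact_basePt, fderiv_toU (actM_hypBase_mem A)
    (by rw [mform_actM, mform_hypBase_tangentBase]), actM_hypBase_sub]
  simp only [cons_val]
  rw [Complex.ofReal_div, Complex.ofReal_neg, h]
  simp
  ring

theorem dact_basePt_horizontal (A : SL2C) (u : Space) :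
    (dact A basePt u 0 : ℂ) + dact A basePt u 1 * Complex.I =
    (star (A.1 1 1) ^ 2 * (u 0 + u 1 * Complex.I)
      - star (A.1 1 0) ^ 2 * (u 0 - u 1 * Complex.I)
      + 2 * star (A.1 1 0) * star (A.1 1 1) * u 2) / (den A : ℂ) ^ 2 := by
  have h := gInv_one_one (actM A (tangentBase u))
  have h' := gInv_zero_one (actM A (tangentBase u))
  have h'' := gInv_zero_one (actM A hypBase)
  rw [gInv_actM, gInv_tangentBase, conj_apply_two] at h h'
  rw [gInv_actM_hypBase, Matrix.smul_apply, mul_conjTranspose_apply] at h''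
  have hden : (den A : ℂ) = A.1 1 0 * star (A.1 1 0) + A.1 1 1 * star (A.1 1 1) := by
    simp [den, Complex.mul_conj]
  have hdet := det_eq A
  rw [dact_basePt, fderiv_toU (actM_hypBase_mem A)
    (by rw [mform_actM, mform_hypBase_tangentBase]), actM_hypBase_sub]
  simp only [cons_val_zero, cons_val_one]
  push_cast at h ⊢
  rw [div_mul_eq_mul_div, ← add_div]
  congr 1
  have : ((actM A (tangentBase u) 1 : ℂ) * den A - actM A hypBase 1 *
      (actM A (tangentBase u) 0 - actM A (tangentBase u) 3)) +
      (actM A (tangentBase u) 2 * den A - actM A hypBase 2 *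
      (actM A (tangentBase u) 0 - actM A (tangentBase u) 3)) * Complex.I =
      (actM A (tangentBase u) 1 + actM A (tangentBase u) 2 * Complex.I) * den A -
      (actM A hypBase 1 + actM A hypBase 2 * Complex.I) *
      (actM A (tangentBase u) 0 - actM A (tangentBase u) 3) := by ring
  rw [this, h, h', h'', hden]
  simp
  -- With the conjugates as independent variables, the claim is a polynomial identity modulo `det A
  -- = 1`.
  generalize (starRingEnd ℂ) (A.1 0 0) = a'
  generalize (starRingEnd ℂ) (A.1 0 1) = b'
  generalize (starRingEnd ℂ) (A.1 1 0) = c'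
  generalize (starRingEnd ℂ) (A.1 1 1) = d'
  linear_combination (d' ^ 2 * (u 0 + u 1 * Complex.I) - c' ^ 2 * (u 0 - u 1 * Complex.I)
      + 2 * c' * d' * u 2) * hdet

/-! ### Frames -/

/-- The numerator of the derivative at the base point. -/
def frameNum (A : SL2C) (u : Space) : Space := ![
  ((A.1 1 1).re ^ 2 - (A.1 1 1).im ^ 2 - (A.1 1 0).re ^ 2 + (A.1 1 0).im ^ 2) * u 0
    + 2 * ((A.1 1 1).re * (A.1 1 1).im + (A.1 1 0).re * (A.1 1 0).im) * u 1
    + 2 * ((A.1 1 0).re * (A.1 1 1).re - (A.1 1 0).im * (A.1 1 1).im) * u 2,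
  ((A.1 1 1).re ^ 2 - (A.1 1 1).im ^ 2 + (A.1 1 0).re ^ 2 - (A.1 1 0).im ^ 2) * u 1
    - 2 * ((A.1 1 1).re * (A.1 1 1).im - (A.1 1 0).re * (A.1 1 0).im) * u 0
    - 2 * ((A.1 1 0).re * (A.1 1 1).im + (A.1 1 0).im * (A.1 1 1).re) * u 2,
  ((A.1 1 1).re ^ 2 + (A.1 1 1).im ^ 2 - (A.1 1 0).re ^ 2 - (A.1 1 0).im ^ 2) * u 2
    - 2 * ((A.1 1 0).re * (A.1 1 1).re + (A.1 1 0).im * (A.1 1 1).im) * u 0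
    + 2 * ((A.1 1 0).im * (A.1 1 1).re - (A.1 1 0).re * (A.1 1 1).im) * u 1]

theorem dact_basePt_eq (A : SL2C) (u : Space) :
    dact A basePt u = ((den A) ^ 2)⁻¹ • frameNum A u := by
  have h1 := dact_basePt_horizontal A u
  have h2 := dact_basePt_two A u
  rw [← Complex.ofReal_pow] at h1 h2
  have e0 := congrArg Complex.re h1
  have e1 := congrArg Complex.im h1
  have e2 := congrArg Complex.re h2
  rw [Complex.div_ofReal_re] at e0 e2
  rw [Complex.div_ofReal_im] at e1
  simp [pow_two] at e0 e1 e2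
  rw [frameNum]
  ext k
  fin_cases k
  · simp only [Fin.zero_eta, e0, Pi.smul_apply, cons_val_zero, smul_eq_mul]
    rw [div_eq_inv_mul, pow_two]; congr 1; ring
  · simp only [Fin.mk_one, e1, Pi.smul_apply, cons_val_one, cons_val_zero, smul_eq_mul]
    rw [div_eq_inv_mul, pow_two]; congr 1; ring
  · simp only [Fin.reduceFinMk, e2, Pi.smul_apply, cons_val, smul_eq_mul]
    rw [div_eq_inv_mul, pow_two]; congr 1; ring

theorem den_eq (A : SL2C) : den A =
    (A.1 1 0).re ^ 2 + (A.1 1 0).im ^ 2 + (A.1 1 1).re ^ 2 + (A.1 1 1).im ^ 2 := by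
  simp only [den, Complex.normSq_apply]; ring

/-- Together with `frameNum_cross` this says that `frameNum A` is `den A` times a rotation. Since `A
p₀` has height `1 / den A`, the derivative at `p₀` is a hyperbolic isometry that preserves
orientation. -/
theorem frameNum_dot (A : SL2C) (u v : Space) :
    frameNum A u ⬝ᵥ frameNum A v = den A ^ 2 * u ⬝ᵥ v := by
  simp only [frameNum, den_eq, dotProduct, Fin.sum_univ_three, cons_val_zero, cons_val_one,
    cons_val]
  ring

theorem frameNum_cross (A : SL2C) (u v : Space) :
    frameNum A u ⨯₃ frameNum A v = den A • frameNum A (u ⨯₃ v) := by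
  rw [cross_apply, cross_apply, den_eq]
  ext k
  fin_cases k <;> simp [frameNum] <;> ring

theorem dact_basePt_dot (A : SL2C) (u v : Space) :
    dact A basePt u ⬝ᵥ dact A basePt v = ((den A) ^ 2)⁻¹ * u ⬝ᵥ v := by
  have hn := (den_pos A).ne'
  rw [dact_basePt_eq, dact_basePt_eq, smul_dotProduct, dotProduct_smul, smul_eq_mul, smul_eq_mul]
  congr 1
  rw [inv_mul_eq_iff_eq_mul₀ (pow_ne_zero 2 hn), frameNum_dot]

theorem hcross_dact_basePt (A : SL2C) (u v : Space) :
    hcross (act A basePt) (dact A basePt u) (dact A basePt v) = dact A basePt (u ⨯₃ v) := by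
  have hn := (den_pos A).ne'
  rw [hcross, act_basePt_two, inv_inv, dact_basePt_eq, dact_basePt_eq, dact_basePt_eq]
  simp only [map_smul, LinearMap.smul_apply, frameNum_cross, smul_smul]
  congr 1
  field_simp

theorem isUnitAt_dact_basePt (A : SL2C) {u : Space} (hu : u ⬝ᵥ u = 1) :
    IsUnitAt (act A basePt) (dact A basePt u) := by
  rw [IsUnitAt, dact_basePt_dot, hu, act_basePt_two, mul_one, inv_pow]

theorem unitary_of_act_basePt {k : SL2C} (h : act k basePt = basePt) :
    star (k.1 1 1) = k.1 0 0 ∧ star (k.1 1 0) = -k.1 0 1 := by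
  have h1 : act k basePt = act 1 basePt := by rw [h, act_one basePt_pos]
  rw [act_basePt_eq_iff, val_one, conjTranspose_one, mul_one] at h1
  have h2 : k.1ᴴ = (k⁻¹).1 := by
    rw [← mul_one (k⁻¹).1, ← h1, ← Matrix.mul_assoc, ← val_mul, inv_mul_cancel, val_one, one_mul]
  rw [val_inv] at h2
  have h3 := congrFun (congrFun h2 1) 1
  have h4 := congrFun (congrFun h2 0) 1
  simp only [conjTranspose_apply, of_apply, cons_val_zero, cons_val_one] at h3 h4
  exact ⟨h3, h4⟩

theorem den_of_act_basePt {k : SL2C} (h : act k basePt = basePt) : den k = 1 := by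
  have h1 := act_basePt_two k
  rw [h] at h1
  simpa [basePt] using h1.symm

theorem act_basePt_of_mul {B k : SL2C} (h : act (B * k) basePt = act B basePt) :
    act k basePt = basePt := by
  have := congrArg (act B⁻¹) h
  rwa [← act_mul B⁻¹ (B * k) basePt_pos, ← act_mul B⁻¹ B basePt_pos, inv_mul_cancel,
    act_one basePt_pos, inv_mul_cancel_left] at this

/-- Two elements with the same image of the base point and of its upward unit vector. -/
theorem exists_eq_mul_dg {A B : SL2C} (h : act A basePt = act B basePt)
    (hz : dact A basePt ![0, 0, 1] = dact B basePt ![0, 0, 1]) :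
    ∃ u : ℂˣ, Complex.normSq u = 1 ∧ A = B * dg u := by
  obtain ⟨k, rfl⟩ : ∃ k, A = B * k := ⟨B⁻¹ * A, by rw [mul_inv_cancel_left]⟩
  have hk : act k basePt = basePt := act_basePt_of_mul h
  rw [dact_mul _ _ basePt_pos, hk] at hz
  have hkz := dact_basePt_injective B hz
  have hden := den_of_act_basePt hk
  obtain ⟨h1, h2⟩ := unitary_of_act_basePt hk
  have h3 := dact_basePt_two k ![0, 0, 1]
  rw [hkz, hden] at h3
  -- Fixing `e_z` gives `|d|² - |c|² = 1` and fixing the base point gives `|c|² + |d|² = 1`, so `c =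
  -- 0`; unitarity then kills `b`.
  have hc : k.1 1 0 = 0 := by
    have h4 : Complex.normSq (k.1 1 1) - Complex.normSq (k.1 1 0) = 1 := by
      apply Complex.ofReal_injective
      simp [Complex.mul_conj] at h3
      simp [← h3]
    rw [den] at hden
    exact Complex.normSq_eq_zero.1 (by linarith)
  have hb : k.1 0 1 = 0 := by rw [hc] at h2; simpa using h2.symm
  have hdet := det_eq k
  rw [hb, zero_mul, sub_zero] at hdet
  have ha : k.1 0 0 ≠ 0 := left_ne_zero_of_mul_eq_one hdet
  refine ⟨Units.mk0 _ ha, ?_, ?_⟩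
  · rw [Units.val_mk0, ← h1]
    rw [den, hc] at hden
    simpa using hden
  · congr 1
    have hd : k.1 1 1 = (k.1 0 0)⁻¹ := eq_inv_of_mul_eq_one_right hdet
    apply SL2C_ext <;> simp [val_dg, hb, hc, hd]

theorem dg_mul (u v : ℂˣ) : dg (u * v) = dg u * dg v := by
  apply Subtype.ext
  rw [val_mul, val_dg, val_dg, val_dg]
  ext i j; fin_cases i <;> fin_cases j <;> simp [Matrix.mul_apply, Fin.sum_univ_two, mul_comm]

theorem dg_one : dg 1 = 1 := by
  apply Subtype.ext
  rw [val_dg, val_one]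
  ext i j; fin_cases i <;> fin_cases j <;> simp

theorem dg_inv (u : ℂˣ) : (dg u)⁻¹ = dg u⁻¹ := by
  rw [inv_eq_iff_mul_eq_one, ← dg_mul, mul_inv_cancel, dg_one]

theorem dg_neg_one : dg (-1) = -1 := by
  apply Subtype.ext
  rw [val_dg, val_neg, val_one]
  ext i j; fin_cases i <;> fin_cases j <;> simp

theorem den_dg (u : ℂˣ) : den (dg u) = (Complex.normSq u)⁻¹ := by
  simp [den, val_dg]

/-- A frame determines its spin frames up to sign. -/
theorem eq_or_eq_neg {A B : SL2C} (h : act A basePt = act B basePt)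
    (hz : dact A basePt ![0, 0, 1] = dact B basePt ![0, 0, 1])
    (hy : dact A basePt ![0, 1, 0] = dact B basePt ![0, 1, 0]) : A = B ∨ A = -B := by
  obtain ⟨u, hu, rfl⟩ := exists_eq_mul_dg h hz
  have hk : act (dg u) basePt = basePt := act_basePt_of_mul h
  rw [dact_mul _ _ basePt_pos, hk] at hy
  have hky := dact_basePt_injective B hy
  -- A diagonal unitary matrix turns the horizontal plane by the square of its entry, so fixing
  -- `e_y` leaves only `u = ±1`.
  have h1 := dact_basePt_horizontal (dg u) ![0, 1, 0]
  rw [hky, den_dg, hu] at h1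
  simp [val_dg] at h1
  rcases h1 with h1 | h1
  · left; rw [show u = 1 from Units.ext (by simpa using congrArg star h1), dg_one, mul_one]
  · right; rw [show u = -1 from Units.ext (by simpa using congrArg star h1), dg_neg_one, mul_neg, mul_one]

theorem actM_neg (A : SL2C) (v : Mink) : actM (-A) v = actM A v :=
  gInv_injective (by rw [gInv_actM, gInv_actM, val_neg]; simp)

theorem act_neg (A : SL2C) : act (-A) = act A := by
  funext x; rw [act_eq, actM_neg, ← act_eq]

theorem dact_neg (A : SL2C) : dact (-A) = dact A := by
  funext x; rw [dact, act_neg, ← dact]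

/-- The isometries acting trivially. -/
theorem eq_one_or_eq_neg_one {k : SL2C} (h : ∀ x : Space, 0 < x 2 → act k x = x) :
    k = 1 ∨ k = -1 := by
  have hd : dact k basePt = ContinuousLinearMap.id ℝ Space :=
    dact_eq_of_eventuallyEq (hasFDerivAt_id _) (fun y hy => h y hy) basePt_pos
  refine eq_or_eq_neg ?_ ?_ ?_
  · rw [h _ basePt_pos, act_one basePt_pos]
  · rw [hd, dact_one basePt_pos]; rfl
  · rw [hd, dact_one basePt_pos]; rfl

/-! ### Screw motions -/

theorem toU_complex {v : Mink} (hv : v ∈ hyperboloid) :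
    ((toU v 0 : ℂ) + toU v 1 * Complex.I) = gInv v 0 1 / gInv v 1 1 := by
  have h1 := gInv_one_one v
  have h2 := gInv_zero_one v
  have h3 : (v 0 - v 3 : ℂ) ≠ 0 := by exact_mod_cast (sub_pos_of_mem hv).ne'
  rw [toU_of_mem hv, ← mul_div_mul_left _ _ (two_ne_zero (α := ℂ)), ← h1, ← h2]
  simp
  field_simp

theorem act_dg (u : ℂˣ) {x : Space} (hx : 0 < x 2) : act (dg u) x =
    ![((u : ℂ) ^ 2 * (x 0 + x 1 * Complex.I)).re, ((u : ℂ) ^ 2 * (x 0 + x 1 * Complex.I)).im,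
      Complex.normSq u * x 2] := by
  have hm := fromU_mem hx
  have hm' := actM_mem (A := dg u) hm
  have hs := (sub_pos_of_mem hm).ne'
  have hu : (starRingEnd ℂ (u : ℂ)) ≠ 0 := by simp
  have e0 : gInv (actM (dg u) (fromU x)) 0 1 =
      u * gInv (fromU x) 0 1 * (starRingEnd ℂ (u : ℂ))⁻¹ := by
    rw [gInv_actM, conj_apply_two, val_dg]; simp
  have e1 : gInv (actM (dg u) (fromU x)) 1 1 =
      (u : ℂ)⁻¹ * gInv (fromU x) 1 1 * (starRingEnd ℂ (u : ℂ))⁻¹ := by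
    rw [gInv_actM, conj_apply_two, val_dg]; simp
  have g1 : gInv (fromU x) 1 1 = ((fromU x 0 - fromU x 3 : ℝ) : ℂ) / 2 := by
    rw [gInv_one_one]; ring
  have hg : gInv (fromU x) 1 1 ≠ 0 := by
    rw [g1]; exact div_ne_zero (by exact_mod_cast hs) two_ne_zero
  have k0 := toU_complex hm'
  have k1 := toU_complex hm
  rw [toU_fromU hx] at k1
  have k2 : ((x 0 : ℂ) + x 1 * Complex.I) * (u : ℂ) ^ 2 = toU (actM (dg u) (fromU x)) 0 +
      toU (actM (dg u) (fromU x)) 1 * Complex.I := by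
    rw [k0, k1, e0, e1]; field_simp
  have k3 : toU (actM (dg u) (fromU x)) 2 = Complex.normSq u * x 2 := by
    have hx2 : x 2 = 1 / (fromU x 0 - fromU x 3) := by
      conv_lhs => rw [← toU_fromU hx, toU_of_mem hm]
      simp
    have hn : (actM (dg u) (fromU x) 0 - actM (dg u) (fromU x) 3) =
        (Complex.normSq u)⁻¹ * (fromU x 0 - fromU x 3) := by
      apply Complex.ofReal_injective
      rw [gInv_one_one, e1, g1]
      push_cast
      rw [← Complex.mul_conj]
      field_simp
    rw [hx2, toU_of_mem hm', hn]
    simp [mul_comm]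
  rw [mul_comm, k2, act_eq]
  ext k
  fin_cases k <;> simp [k3]

/-- The exponential as a unit. -/
def expU (d : ℂ) : ℂˣ := Units.mk0 (Complex.exp d) (Complex.exp_ne_zero d)

/-- The Möbius map of `dg u` is multiplication by `u²`, hence the half in the exponent. This is the
source of `d / 2` in the lambda length. -/
theorem act_dg_expU (d : ℂ) {x : Space} (hx : 0 < x 2) : act (dg (expU (d / 2))) x = screw d x := by
  have h : (expU (d / 2) : ℂ) ^ 2 = Complex.exp d := by
    rw [expU, Units.val_mk0, ← Complex.exp_nat_mul]; congr 1; push_cast; ring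
  have h2 : Complex.normSq (expU (d / 2)) = Real.exp d.re := by
    rw [Complex.normSq_eq_norm_sq, ← norm_pow, h, Complex.norm_exp]
  rw [act_dg _ hx, h, h2]; rfl

theorem continuous_SL2C {X : Type*} [TopologicalSpace X] {F : X → SL2C}
    (h : ∀ i j, Continuous fun x => (F x).1 i j) : Continuous F :=
  continuous_induced_rng.2 (continuous_matrix h)

/-- The set `{1, -1}` is discrete, so a continuous sign on a connected space is constant. This
serves both for the uniqueness of path lifts and for the global sign of a spin lift. -/
theorem eq_of_sign {X : Type*} [TopologicalSpace X] [PreconnectedSpace X] {F : X → SL2C}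
    (hF : Continuous F) (h : ∀ x, F x = 1 ∨ F x = -1) (x y : X) : F x = F y := by
  have hfin : ({1, -1} : Set SL2C).Finite := by simp
  have : DiscreteTopology ({1, -1} : Set SL2C) := hfin.isDiscrete.to_subtype
  have := PreconnectedSpace.constant (Y := ({1, -1} : Set SL2C)) inferInstance
    (f := fun x => (⟨F x, h x⟩ : ({1, -1} : Set SL2C))) (hF.subtype_mk _) (x := x) (y := y)
  exact congrArg Subtype.val this

theorem continuous_dg_expU {X : Type*} [TopologicalSpace X] {φ : X → ℂ} (h : Continuous φ) :
    Continuous fun x => dg (expU (φ x)) := by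
  refine continuous_SL2C fun i j => ?_
  have h1 : Continuous fun x => Complex.exp (φ x) := Complex.continuous_exp.comp h
  have h2 : Continuous fun x => (Complex.exp (φ x))⁻¹ := h1.inv₀ fun x => Complex.exp_ne_zero _
  simp only [val_dg, expU, Units.val_mk0]
  fin_cases i <;> fin_cases j <;> simp <;> first | exact h1 | exact h2 | exact continuous_const

theorem expU_zero : expU 0 = 1 := Units.ext Complex.exp_zero

/-- The one-parameter subgroup through `dg`, conjugated by `A`, is one lift of the path of screw
motions. Any other lift differs from it by a continuous sign, which is `1` at time `0`. -/
theorem isSpinScrew_iff {A B : SL2C} {d : ℂ} :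
    IsSpinScrew A d B ↔ B = A * dg (expU (d / 2)) * A⁻¹ := by
  have hcont : Continuous fun t : unitInterval =>
      A * dg (expU (((t : ℝ) : ℂ) * d / 2)) * A⁻¹ := by
    refine (continuous_const.mul (continuous_dg_expU ?_)).mul continuous_const
    fun_prop
  have hact : ∀ (t : unitInterval) (x : Space), 0 < x 2 →
      act (A * dg (expU (((t : ℝ) : ℂ) * d / 2)) * A⁻¹) x =
        act A (screw (((t : ℝ) : ℂ) * d) (act A⁻¹ x)) := fun t x hx => by
    rw [act_mul _ _ hx, act_mul _ _ (act_pos _ hx), act_dg_expU _ (act_pos _ hx)]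
  constructor
  · rintro ⟨M, hM, hM0, rfl, hMt⟩
    have h := eq_of_sign (F := fun t : unitInterval => (A * dg (expU (((t : ℝ) : ℂ) * d / 2)) * A⁻¹)⁻¹ * M t)
      (hcont.inv.mul hM) (fun t => eq_one_or_eq_neg_one fun x hx => by
        rw [act_mul _ _ hx, hMt t x hx, ← hact t x hx, ← act_mul _ _ hx, inv_mul_cancel,
          act_one hx]) 1 0
    simp only [Set.Icc.coe_one, Set.Icc.coe_zero, Complex.ofReal_one, Complex.ofReal_zero,
      zero_mul, zero_div, expU_zero, dg_one, mul_one, mul_inv_cancel, hM0, inv_one, one_mul] at h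
    exact (inv_mul_eq_one.1 h).symm
  · rintro rfl
    exact ⟨_, hcont, by simp [expU_zero, dg_one], by simp, hact⟩

/-! ### Geodesics -/

theorem act_dg_basePt (u : ℂˣ) : act (dg u) basePt = ![0, 0, Complex.normSq u] := by
  rw [act_dg u basePt_pos]; ext k; fin_cases k <;> simp [basePt]

theorem dact_dg_basePt (u : ℂˣ) :
    dact (dg u) basePt ![0, 0, 1] = ![0, 0, Complex.normSq u] := by
  have hu : Complex.normSq u ≠ 0 := by simp
  rw [dact_basePt_eq, den_dg]
  have h := Complex.normSq_inv (u : ℂ)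
  rw [Complex.normSq_apply] at h
  ext k; fin_cases k <;> simp [frameNum, val_dg] at h ⊢
  rw [← pow_two, ← pow_two] at h
  rw [h]; field_simp

theorem geod_eq (A : SL2C) {u : ℂˣ} {t : ℝ} (h : Complex.normSq u = Real.exp t) :
    geod A t = act (A * dg u) basePt ∧ deriv (geod A) t = dact (A * dg u) basePt ![0, 0, 1] := by
  rw [act_mul _ _ basePt_pos, dact_mul _ _ basePt_pos, act_dg_basePt, dact_dg_basePt, h]
  refine ⟨rfl, ?_⟩
  have h1 : HasDerivAt (fun t : ℝ => (![0, 0, Real.exp t] : Space)) ![0, 0, Real.exp t] t := by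
    rw [hasDerivAt_pi]
    intro i
    fin_cases i
    · simpa using hasDerivAt_const t (0 : ℝ)
    · simpa using hasDerivAt_const t (0 : ℝ)
    · simpa using Real.hasDerivAt_exp t
  have h2 := (differentiableAt_act A (x := ![0, 0, Real.exp t])
    (by simpa using Real.exp_pos t)).hasFDerivAt
  exact (h2.comp_hasDerivAt t h1).deriv

theorem exists_normSq_eq_exp (t : ℝ) : ∃ u : ℂˣ, Complex.normSq u = Real.exp t := by
  refine ⟨expU ((t / 2 : ℝ) : ℂ), ?_⟩
  rw [expU, Units.val_mk0, Complex.normSq_eq_norm_sq, Complex.norm_exp, ← Real.exp_nat_mul,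
    Complex.ofReal_re]
  congr 1; push_cast; ring

/-- The base point and first vector determine a spin frame up to a unitary diagonal factor on the
right, and moving along `γ_A` is a diagonal factor of varying modulus. -/
theorem isAdapted_iff {A s : SL2C} : IsAdapted A s ↔ ∃ v : ℂˣ, s = A * dg v := by
  constructor
  · rintro ⟨t, h1, h2⟩
    obtain ⟨v, hv⟩ := exists_normSq_eq_exp t
    rw [(geod_eq A hv).1] at h1
    rw [(geod_eq A hv).2] at h2
    obtain ⟨u, -, rfl⟩ := exists_eq_mul_dg h1 h2
    exact ⟨v * u, by rw [dg_mul, mul_assoc]⟩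
  · rintro ⟨v, rfl⟩
    have hv : 0 < Complex.normSq v := by simp
    have h := geod_eq A (u := v) (Real.exp_log hv).symm
    exact ⟨_, h.1.symm, h.2.symm⟩

theorem act_mul_dg_mem_range (A : SL2C) (v : ℂˣ) :
    act (A * dg v) basePt ∈ Set.range (geod A) := by
  have hv : 0 < Complex.normSq v := by simp
  exact ⟨_, (geod_eq A (u := v) (Real.exp_log hv).symm).1⟩

theorem expU_apply (d : ℂ) : (expU d : ℂ) = Complex.exp d := rfl

theorem dg_injective : Function.Injective dg := fun u v h => by
  have := congrFun (congrFun (congrArg Subtype.val h) 0) 0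
  rw [val_dg, val_dg] at this
  exact Units.ext (by simpa using this)

/-- The screw motion `A * dg u * A⁻¹` acts on `A * dg v₁` from the left, which turns it into
multiplication of the diagonal parameter. -/
theorem isComplexDistance_iff {A s₁ s₂ : SL2C} {d : ℂ} : IsComplexDistance A s₁ s₂ d ↔
    ∃ v₁ v₂ : ℂˣ, s₁ = A * dg v₁ ∧ s₂ = A * dg v₂ ∧ (v₂ : ℂ) = Complex.exp (d / 2) * v₁ := by
  rw [IsComplexDistance, isAdapted_iff, isAdapted_iff]
  constructor
  · rintro ⟨⟨v₁, rfl⟩, ⟨v₂, rfl⟩, B, hB, h⟩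
    refine ⟨v₁, v₂, rfl, rfl, ?_⟩
    rw [isSpinScrew_iff.1 hB, mul_assoc, inv_mul_cancel_left, mul_assoc, mul_right_inj,
      ← dg_mul] at h
    rw [dg_injective h]; rfl
  · rintro ⟨v₁, v₂, rfl, rfl, h⟩
    refine ⟨⟨_, rfl⟩, ⟨_, rfl⟩, _, isSpinScrew_iff.2 rfl, ?_⟩
    rw [mul_assoc, inv_mul_cancel_left, mul_assoc, ← dg_mul]
    congr 2
    exact Units.ext h

/-! ### Spinors and horospheres -/

/-- The first column. -/
def col (A : SL2C) : Spinor := fun i => A.1 i 0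

/-- The point of the light cone of a spinor. -/
def conePt (κ : Spinor) : Mink := g (f κ)

/-- The point of the light cone of the spinor `(1, 0)`. -/
def coneBase : Mink := ![1, 0, 0, 1]

theorem gInv_conePt (κ : Spinor) : gInv (conePt κ) = vecMulVec κ (star κ) := gInv_g _

theorem gInv_coneBase : gInv coneBase = !![1, 0; 0, 0] := by
  ext i j; fin_cases i <;> fin_cases j <;> simp [gInv, coneBase]

/-- Equivariance of `κ ↦ κ κ*`: the vector `coneBase` is the matrix unit of the spinor `(1, 0)`.
Statements about an arbitrary spinor are moved to this one by a matrix with first column `κ`. -/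
theorem conePt_col (A : SL2C) : conePt (col A) = actM A coneBase := by
  refine gInv_injective ?_
  rw [gInv_conePt, gInv_actM, gInv_coneBase]
  ext i j
  rw [conj_apply_two]
  simp [col, vecMulVec_apply]

theorem col_mul (A B : SL2C) : col (A * B) = A.1 *ᵥ col B := by
  ext i; simp [col, Matrix.mul_apply, mulVec, dotProduct]

theorem col_neg (A : SL2C) : col (-A) = -col A := by
  ext i; simp [col]

theorem col_ne_zero (A : SL2C) : col A ≠ 0 := by
  intro h
  have h0 : A.1 0 0 = 0 := congrFun h 0
  have h1 : A.1 1 0 = 0 := congrFun h 1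
  have := det_eq A
  rw [h0, h1] at this
  simp at this

/-- The squared norm of a spinor. -/
def spinorSq (κ : Spinor) : ℝ := Complex.normSq (κ 0) + Complex.normSq (κ 1)

theorem spinorSq_pos {κ : Spinor} (h : κ ≠ 0) : 0 < spinorSq κ := by
  by_contra hc
  have h0 := Complex.normSq_nonneg (κ 0)
  have h1 := Complex.normSq_nonneg (κ 1)
  rw [spinorSq] at hc
  apply h
  ext i
  fin_cases i
  · exact Complex.normSq_eq_zero.1 (show Complex.normSq (κ 0) = 0 by linarith)
  · exact Complex.normSq_eq_zero.1 (show Complex.normSq (κ 1) = 0 by linarith)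

/-- The special linear matrix with orthogonal columns and first column `κ`. -/
def sec (κ : {κ : Spinor // κ ≠ 0}) : SL2C :=
  ⟨!![κ.1 0, -star (κ.1 1) / spinorSq κ.1; κ.1 1, star (κ.1 0) / spinorSq κ.1], by
    have h : (spinorSq κ.1 : ℂ) ≠ 0 := mk0_ne (spinorSq_pos κ.2)
    rw [det_fin_two_of]
    field_simp
    simp [spinorSq, ← Complex.mul_conj, sub_neg_eq_add, mul_comm]⟩

theorem col_sec (κ : {κ : Spinor // κ ≠ 0}) : col (sec κ) = κ.1 := by
  ext i; fin_cases i <;> rfl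

theorem col_mul_uni (A : SL2C) (w : ℂ) : col (A * uni w) = col A := by
  ext i; simp [col, val_uni, Matrix.mul_apply]

theorem mform_hypBase_coneBase : mform hypBase coneBase = 1 := by
  simp [mform, hypBase, coneBase]

theorem exists_of_mem_horoH_coneBase {x : Mink} (hx : x ∈ horoH coneBase) :
    ∃ w, x = actM (uni w) hypBase := by
  obtain ⟨w, s, hs, h⟩ := exists_uni_dg hx.1
  have h1 : x 0 - x 3 = 1 := by simpa [mform, coneBase] using hx.2
  rw [h1] at hs
  have : s = 1 := Units.ext (by simpa using hs)
  exact ⟨w, by rw [h, this, dg_one, mul_one]⟩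

/-- Transport to `coneBase`, whose horosphere `T - Z = 1` is the orbit of the base point under the
unipotent matrices; right multiplication by these does not change the first column. -/
theorem mem_horoH_conePt {κ : Spinor} (hκ : κ ≠ 0) {x : Mink} :
    x ∈ horoH (conePt κ) ↔ ∃ W, col W = κ ∧ x = actM W hypBase := by
  constructor
  · intro hx
    have h := col_sec ⟨κ, hκ⟩
    set W := sec ⟨κ, hκ⟩
    dsimp only at h
    have h2 : actM W⁻¹ x ∈ horoH coneBase := by
      refine ⟨actM_mem hx.1, ?_⟩
      rw [← mform_actM W, actM_actM_inv, ← conePt_col, h]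
      exact hx.2
    obtain ⟨w, hw⟩ := exists_of_mem_horoH_coneBase h2
    exact ⟨W * uni w, by rw [col_mul_uni, h], by rw [actM_mul, ← hw, actM_actM_inv]⟩
  · rintro ⟨W, rfl, rfl⟩
    exact ⟨actM_hypBase_mem W, by rw [conePt_col, mform_actM, mform_hypBase_coneBase]⟩

theorem K_carrier (κ : Spinor) : (K κ).carrier = toU '' horoH (conePt κ) := by
  have : (K κ).carrier = jMap '' (iMap '' horoH (conePt κ)) := rfl
  rw [this, Set.image_image]; rfl

theorem mem_K_carrier {κ : Spinor} (hκ : κ ≠ 0) {q : Space} :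
    q ∈ (K κ).carrier ↔ ∃ W, col W = κ ∧ act W basePt = q := by
  rw [K_carrier]
  constructor
  · rintro ⟨x, hx, rfl⟩
    obtain ⟨W, hW, rfl⟩ := (mem_horoH_conePt hκ).1 hx
    exact ⟨W, hW, act_basePt W⟩
  · rintro ⟨W, hW, rfl⟩
    exact ⟨_, (mem_horoH_conePt hκ).2 ⟨W, hW, rfl⟩, (act_basePt W).symm⟩

theorem mem_K_col (W : SL2C) : act W basePt ∈ (K (col W)).carrier :=
  (mem_K_carrier (col_ne_zero W)).2 ⟨W, rfl, rfl⟩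

/-- The quotient `B⁻¹ A` is unitary with first column `(1, 0)`, hence trivial. -/
theorem eq_of_col_eq {A B : SL2C} (hc : col A = col B) (h : act A basePt = act B basePt) :
    A = B := by
  obtain ⟨k, rfl⟩ : ∃ k, A = B * k := ⟨B⁻¹ * A, by rw [mul_inv_cancel_left]⟩
  have hk : col k = col 1 := by
    rw [← one_mul k, ← inv_mul_cancel B, mul_assoc, col_mul, hc, ← col_mul, inv_mul_cancel]
  obtain ⟨h1, h2⟩ := unitary_of_act_basePt (act_basePt_of_mul h)
  have e0 : k.1 0 0 = 1 := congrFun hk 0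
  have e1 : k.1 1 0 = 0 := congrFun hk 1
  rw [e0] at h1
  rw [e1] at h2
  have : k = 1 := SL2C_ext (by rw [e0]; rfl) (by simpa [val_one] using h2.symm)
    (by rw [e1]; rfl) (by simpa [val_one] using congrArg star h1)
  rw [this, mul_one]

/-- A vector is determined by its products with the points of a horosphere. -/
theorem eq_coneBase {p : Mink} (h : ∀ x ∈ horoH coneBase, mform x p = 1) : p = coneBase := by
  -- Points of the standard horosphere; five of them give linear equations that determine `p`.
  have hm : ∀ a b : ℝ, (![1 + (a ^ 2 + b ^ 2) / 2, a, b, (a ^ 2 + b ^ 2) / 2] : Mink) ∈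
      horoH coneBase := by
    intro a b
    refine ⟨⟨?_, ?_⟩, ?_⟩
    · simp [mform]; ring
    · simp; positivity
    · simp [mform, coneBase]
  have h1 := h _ (hm 0 0)
  have h2 := h _ (hm 1 0)
  have h3 := h _ (hm (-1) 0)
  have h4 := h _ (hm 0 1)
  have h5 := h _ (hm 0 (-1))
  simp [mform] at h1 h2 h3 h4 h5
  ext k
  fin_cases k <;> simp [coneBase] <;> linarith

theorem eq_conePt {κ : Spinor} (hκ : κ ≠ 0) {p : Mink} (h : horoH p = horoH (conePt κ)) :
    p = conePt κ := by
  have hc := col_sec ⟨κ, hκ⟩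
  set W := sec ⟨κ, hκ⟩
  dsimp only at hc
  have h2 : actM W⁻¹ p = coneBase := eq_coneBase fun x hx => by
    obtain ⟨w, rfl⟩ := exists_of_mem_horoH_coneBase hx
    rw [← mform_actM W, actM_actM_inv, ← actM_mul]
    have : actM (W * uni w) hypBase ∈ horoH p := by
      rw [h]; exact (mem_horoH_conePt hκ).2 ⟨_, by rw [col_mul_uni, hc], rfl⟩
    exact this.2
  rw [← hc, conePt_col, ← h2, actM_actM_inv]

theorem horoH_subset (p : Mink) : horoH p ⊆ hyperboloid := fun _ hx => hx.1

theorem eq_conePt_of_image {κ : Spinor} (hκ : κ ≠ 0) {p : Mink}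
    (h : toU '' horoH p = (K κ).carrier) : p = conePt κ := by
  rw [K_carrier] at h
  exact eq_conePt hκ ((toU_injOn.image_eq_image_iff (horoH_subset _) (horoH_subset _)).1 h)

/-- The cone point of a `Horosphere` is obtained by choice, so it has to be recovered from the
carrier before the centre or tangent spaces can be computed. -/
theorem Horosphere.cone_eq {κ : Spinor} (hκ : κ ≠ 0) {h : Horosphere}
    (hh : h.carrier = (K κ).carrier) : h.cone = conePt κ :=
  eq_conePt_of_image hκ (by rw [← hh]; exact h.isHoro.choose_spec.2.symm)

theorem conePt_mem {κ : Spinor} (hκ : κ ≠ 0) : conePt κ ∈ lightCone := by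
  have h := col_sec ⟨κ, hκ⟩
  refine ⟨?_, ?_⟩
  · dsimp only at h
    rw [← h, conePt_col, mform_actM]; simp [mform, coneBase]
  · have h0 : conePt κ 0 = spinorSq κ := by
      apply Complex.ofReal_injective
      rw [two_mul_gInv_zero, gInv_conePt]
      simp [vecMulVec_apply, spinorSq, Complex.mul_conj]
    rw [h0]; exact spinorSq_pos hκ

/-! ### Boundary points -/

open Classical in
/-- The boundary point `ξ / η` of a spinor. -/
def spinorBdry (κ : Spinor) : OnePoint ℂ :=
  if κ 1 = 0 then OnePoint.infty else ((κ 0 / κ 1 : ℂ) : OnePoint ℂ)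

/-- For the cone point of `(ξ, η)` one has `T - Z = 2|η|²` and `X + iY = 2 ξ η̄`, with quotient `ξ /
η`. -/
theorem boundaryPt_conePt {κ : Spinor} (hκ : κ ≠ 0) : boundaryPt (conePt κ) = spinorBdry κ := by
  have hp := (conePt_mem hκ).2
  have h1 := gInv_one_one (conePt κ)
  have h2 := gInv_zero_one (conePt κ)
  rw [gInv_conePt, vecMulVec_apply] at h1 h2
  have hpc : (conePt κ 0 : ℂ) ≠ 0 := mk0_ne hp
  have hiff : conePt κ 3 / conePt κ 0 = 1 ↔ κ 1 = 0 := by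
    rw [div_eq_one_iff_eq hp.ne', eq_comm, ← sub_eq_zero, ← Complex.ofReal_eq_zero, h1]
    simp
  rw [boundaryPt, spinorBdry]
  simp only [hiff]
  split_ifs with h
  · rfl
  · congr 1
    have hs : star (κ 1) ≠ 0 := by simpa using h
    have e : ((conePt κ 1 / conePt κ 0 : ℝ) + (conePt κ 2 / conePt κ 0 : ℝ) * Complex.I : ℂ) =
        2 * (κ 0 * star κ 1) / conePt κ 0 := by
      rw [← h2]; push_cast; field_simp
    have e' : (1 - (conePt κ 3 / conePt κ 0 : ℝ) : ℂ) = 2 * (κ 1 * star κ 1) / conePt κ 0 := by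
      rw [← h1]; push_cast; field_simp
    rw [e, e', Pi.star_apply]
    field_simp

theorem spinorBdry_eq_iff {κ κ' : Spinor} (h : κ ≠ 0) (h' : κ' ≠ 0) :
    spinorBdry κ = spinorBdry κ' ↔ spinorDet κ κ' = 0 := by
  have key : ∀ {κ : Spinor}, κ ≠ 0 → κ 1 = 0 → κ 0 ≠ 0 := fun {κ} h h1 h0 =>
    h (by ext i; fin_cases i <;> assumption)
  rw [spinorBdry, spinorBdry, spinorDet]
  split_ifs with h1 h2 h2
  · simp [h1, h2]
  · simp [h1, h2, key h h1]
  · simp [h1, h2, key h' h2]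
  · rw [OnePoint.coe_eq_coe, div_eq_div_iff h1 h2, sub_eq_zero]

theorem actBoundary_infty (A : SL2C) : actBoundary A OnePoint.infty = spinorBdry (col A) := by
  rw [actBoundary, OnePoint.smul_infty_eq_ite, spinorBdry]; rfl

theorem actBoundary_zero (A : SL2C) :
    actBoundary A ((0 : ℂ) : OnePoint ℂ) = spinorBdry fun i => A.1 i 1 := by
  rw [actBoundary, OnePoint.smul_some_eq_ite, spinorBdry]
  simp only [mul_zero, zero_add]; rfl

theorem exists_smul_of_spinorDet {κ κ' : Spinor} (h : κ ≠ 0) (hd : spinorDet κ κ' = 0) :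
    ∃ c : ℂ, κ' = c • κ := by
  rw [spinorDet] at hd
  by_cases h0 : κ 0 = 0
  · have h1 : κ 1 ≠ 0 := fun h1 => h (by ext i; fin_cases i <;> assumption)
    refine ⟨κ' 1 / κ 1, ?_⟩
    rw [h0] at hd
    have : κ' 0 = 0 := by simpa [h1] using hd
    ext i; fin_cases i
    · simp [h0, this]
    · simp [h1]
  · refine ⟨κ' 0 / κ 0, ?_⟩
    ext i; fin_cases i
    · simp [h0]
    · simp; field_simp; linear_combination hd

theorem exists_smul_of_conePt {κ κ' : Spinor} (h : κ ≠ 0) (h' : κ' ≠ 0)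
    (hd : conePt κ = conePt κ') : ∃ c : ℂ, κ' = c • κ := by
  refine exists_smul_of_spinorDet h ((spinorBdry_eq_iff h h').1 ?_)
  rw [← boundaryPt_conePt h, hd, boundaryPt_conePt h']

/-! ### Tangent vectors -/

theorem tangentBase_eq {v : Mink} (hx : mform hypBase v = 0) (hp : mform coneBase v = 0) :
    v = tangentBase ![v 1, v 2, 0] := by
  simp [mform, hypBase, coneBase] at hx hp
  have h3 : v 3 = 0 := by linarith
  ext k; fin_cases k <;> simp [tangentBase, hx, h3]

/-- By invariance of the form, `W` carries the horizontal plane at the base point, orthogonal to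
`hypBase` and `coneBase`, onto this tangent plane. -/
theorem mem_horoTangentH {W : SL2C} {v : Mink} :
    v ∈ horoTangentH (conePt (col W)) (actM W hypBase) ↔
      ∃ s t : ℝ, v = actM W (tangentBase ![s, t, 0]) := by
  constructor
  · rintro ⟨h1, h2⟩
    rw [← actM_actM_inv W v, mform_actM] at h1
    rw [conePt_col, ← actM_actM_inv W v, mform_actM] at h2
    exact ⟨_, _, by rw [← tangentBase_eq h1 h2, actM_actM_inv]⟩
  · rintro ⟨s, t, rfl⟩
    refine ⟨by rw [mform_actM, mform_hypBase_tangentBase], ?_⟩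
    rw [conePt_col, mform_actM]; simp [mform, coneBase, tangentBase]

theorem fromU_act_basePt (W : SL2C) : fromU (act W basePt) = actM W hypBase := by
  rw [act_basePt, fromU_toU (actM_hypBase_mem W)]

theorem Horosphere.mem_tangent {W : SL2C} {h : Horosphere}
    (hh : h.carrier = (K (col W)).carrier) {v : Space} :
    v ∈ h.tangent (act W basePt) ↔ ∃ s t : ℝ, v = dact W basePt ![s, t, 0] := by
  rw [Horosphere.tangent, Horosphere.cone_eq (col_ne_zero W) hh, ← fromU, fromU_act_basePt]
  constructor
  · rintro ⟨u, hu, rfl⟩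
    obtain ⟨s, t, rfl⟩ := mem_horoTangentH.1 hu
    exact ⟨s, t, (dact_basePt W _).symm⟩
  · rintro ⟨s, t, rfl⟩
    exact ⟨_, mem_horoTangentH.2 ⟨s, t, rfl⟩, (dact_basePt W _).symm⟩

/-! ### The oriented line field -/

/-- The vector spanning the flag of a spinor, modulo the point of the flag. -/
theorem exists_flag_vector (W : SL2C) : ∃ a r : ℝ, 0 < r ∧ g (Df (col W) (Zmap (col W))) =
    a • conePt (col W) + r • actM W (tangentBase ![0, 1, 0]) := by
  have hdet := det_eq W
  -- Cramer's rule in the basis of the columns `κ, w` of `W`: `Z(κ) = z κ - i|κ|² w`. The first term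
  -- changes the flag vector only by a real multiple of `p`; the second gives the image of `e_y`.
  set z : ℂ := Zmap (col W) 0 * W.1 1 1 - W.1 0 1 * Zmap (col W) 1 with hz
  set R : ℝ := spinorSq (col W)
  have hR : (R : ℂ) = W.1 0 0 * star (W.1 0 0) + W.1 1 0 * star (W.1 1 0) := by
    simp [R, spinorSq, col, ← Complex.mul_conj]
  have hZ : ∀ i, Zmap (col W) i = z * W.1 i 0 - Complex.I * R * W.1 i 1 := by
    intro i
    rw [hR]
    fin_cases i <;> simp [hz, Zmap, col]
    · linear_combination (-Complex.I * starRingEnd ℂ (W.1 1 0)) * hdet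
    · linear_combination (Complex.I * starRingEnd ℂ (W.1 0 0)) * hdet
  refine ⟨2 * z.re, 2 * R, mul_pos two_pos (spinorSq_pos (col_ne_zero W)), gInv_injective ?_⟩
  rw [gInv_g, gInv_add, gInv_smul, gInv_smul, gInv_conePt, gInv_actM, gInv_tangentBase]
  have hzz : ((2 * z.re : ℝ) : ℂ) = z + star z := by
    rw [Complex.star_def, Complex.add_conj]
  ext i j
  rw [Matrix.add_apply, Matrix.smul_apply, Matrix.smul_apply, conj_apply_two, hzz]
  simp only [Df, Matrix.add_apply, vecMulVec_apply, Pi.star_apply, hZ]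
  simp [col]
  ring

theorem differentiableAt_iMap {v : Mink} (hv : 0 < v 0) : DifferentiableAt ℝ iMap v := by
  have h0 : 1 + v 0 ≠ 0 := by positivity
  unfold iMap
  rw [differentiableAt_pi]
  intro i
  fin_cases i <;> simp <;> fun_prop (disch := exact h0)

theorem differentiableAt_jMap {x : Space} (hx : x 0 ^ 2 + x 1 ^ 2 + (1 - x 2) ^ 2 ≠ 0) :
    DifferentiableAt ℝ jMap x := by
  unfold jMap
  rw [differentiableAt_pi]
  intro i
  fin_cases i <;> simp [dotProduct, Fin.sum_univ_three] <;> fun_prop (disch := exact hx)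

/-- `K` pushes its line field forward in two stages, so the chain rule is needed to compare it with
`toU`. -/
theorem fderiv_toU_eq {v : Mink} (hv : v ∈ hyperboloid) (u : Mink) :
    fderiv ℝ toU v u = fderiv ℝ jMap (iMap v) (fderiv ℝ iMap v u) := by
  have h0 : 1 + v 0 ≠ 0 := by have := hv.2; positivity
  have hD : iMap v 0 ^ 2 + iMap v 1 ^ 2 + (1 - iMap v 2) ^ 2 ≠ 0 := by
    have : 0 < 1 - iMap v 2 := by
      have := sub_pos_of_mem hv
      have h2 := hv.2
      simp only [iMap, cons_val]
      rw [sub_pos, div_lt_one (by positivity)]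
      linarith
    positivity
  have : toU = jMap ∘ iMap := rfl
  rw [this, fderiv_comp v (differentiableAt_jMap hD) (differentiableAt_iMap hv.2)]
  rfl

theorem mem_K_dir {W : SL2C} {w : Space} : w ∈ (K (col W)).dir (act W basePt) ↔
    ∃ c : ℝ, 0 < c ∧ w = c • dact W basePt ![0, 1, 0] := by
  obtain ⟨a, r, hr, hv⟩ := exists_flag_vector W
  have hmem : actM W hypBase ∈ horoH (conePt (col W)) :=
    (mem_horoH_conePt (col_ne_zero W)).2 ⟨W, rfl, rfl⟩
  constructor
  · rintro ⟨y, -, hyq, v', ⟨x, hx, rfl, v, ⟨-, ⟨h1, -⟩, S, ⟨α, β, hβ, hS⟩, hv'⟩, rfl⟩, rfl⟩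
    have hx' : x ∈ horoH (conePt (col W)) := hx
    have hxW : x = actM W hypBase := toU_injOn hx'.1 (actM_hypBase_mem W) (by
      rw [← act_basePt]; exact hyq)
    have hv2 : v = (α + β * a) • conePt (col W) + (β * r) • actM W (tangentBase ![0, 1, 0]) := by
      rw [← hv', hS, map_add, map_smul, map_smul, hv, smul_add, smul_smul, smul_smul, add_smul,
        add_assoc]
      rfl
    -- Orthogonality to `x` kills the component along `p`, because `⟨x, p⟩ = 1`.
    rw [hv2, hxW, mform_add_right, mform_smul_right, mform_smul_right, mform_actM,
      mform_hypBase_tangentBase, hmem.2, mul_zero, add_zero, mul_one] at h1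
    refine ⟨β * r, mul_pos hβ hr, ?_⟩
    rw [← fderiv_toU_eq hx'.1, hv2, h1, zero_smul, zero_add, map_smul, hxW, dact_basePt]
  · rintro ⟨c, hc, rfl⟩
    -- The coefficient of `p` cancels the `a` part of the flag vector, and `c / r` rescales the rest
    -- to `c`.
    have hS : g ((-(c / r * a)) • f (col W) + (c / r) • Df (col W) (Zmap (col W))) =
        c • actM W (tangentBase ![0, 1, 0]) := by
      rw [map_add, map_smul, map_smul, hv, smul_add, smul_smul, smul_smul,
        div_mul_cancel₀ _ hr.ne', ← add_assoc, ← conePt, ← add_smul, neg_add_cancel, zero_smul,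
        zero_add]
    have hT : c • actM W (tangentBase ![0, 1, 0]) ∈
        horoTangentH (conePt (col W)) (actM W hypBase) := by
      refine mem_horoTangentH.2 ⟨0, c, ?_⟩
      rw [← actM_smul]
      congr 1
      ext k; fin_cases k <;> simp [tangentBase]
    refine ⟨iMap (actM W hypBase), ⟨_, hmem, rfl⟩, (act_basePt W).symm, _,
      ⟨_, hmem, rfl, c • actM W (tangentBase ![0, 1, 0]),
        ⟨⟨_, ?_, hS⟩, hT, _, ⟨-(c / r * a), c / r, div_pos hc hr, rfl⟩, hS⟩, rfl⟩, ?_⟩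
    · exact Submodule.add_mem _
        (Submodule.smul_mem _ _ (Submodule.subset_span (Set.mem_insert _ _)))
        (Submodule.smul_mem _ _ (Submodule.subset_span (Set.mem_insert_of_mem _ rfl)))
    · rw [← fderiv_toU_eq (actM_hypBase_mem W), map_smul, dact_basePt]

/-! ### Decorations of a horosphere -/

/-- The rotation by `π` about the second vector of the base frame. -/
def halfTurn : SL2C := ⟨!![0, -1; 1, 0], by simp [det_fin_two_of]⟩

/-- A rotation taking the first vector of the base frame to the second. -/
def quarterTurn : SL2C :=
  ⟨((Real.sqrt 2)⁻¹ : ℂ) • !![1, -Complex.I; -Complex.I, 1], by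
    have h : ((Real.sqrt 2 : ℝ) : ℂ) ^ 2 = 2 := by
      exact_mod_cast Real.sq_sqrt (by norm_num : (0 : ℝ) ≤ 2)
    rw [det_smul, det_fin_two_of]
    simp [h]
    norm_num⟩

theorem val_halfTurn : halfTurn.1 = !![0, -1; 1, 0] := rfl

theorem val_quarterTurn :
    quarterTurn.1 = ((Real.sqrt 2)⁻¹ : ℂ) • !![1, -Complex.I; -Complex.I, 1] := rfl

theorem sqrt_two_inv_sq : ((Real.sqrt 2 : ℝ) : ℂ)⁻¹ * ((Real.sqrt 2 : ℝ) : ℂ)⁻¹ = 1 / 2 := by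
  have h : ((Real.sqrt 2 : ℝ) : ℂ) * Real.sqrt 2 = 2 := by
    exact_mod_cast Real.mul_self_sqrt (by norm_num : (0 : ℝ) ≤ 2)
  rw [← mul_inv, h, one_div]

theorem act_basePt_of_mul_conjTranspose {k : SL2C} (h : k.1 * k.1ᴴ = 1) :
    act k basePt = basePt := by
  rw [← act_one basePt_pos, act_one basePt_pos (x := basePt)]
  conv_rhs => rw [← act_one basePt_pos]
  exact act_basePt_eq_iff.2 (by rw [h, val_one, conjTranspose_one, mul_one])

theorem act_halfTurn : act halfTurn basePt = basePt := by
  refine act_basePt_of_mul_conjTranspose ?_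
  ext i j
  rw [mul_conjTranspose_apply, val_halfTurn]
  fin_cases i <;> fin_cases j <;> simp

theorem act_quarterTurn : act quarterTurn basePt = basePt := by
  refine act_basePt_of_mul_conjTranspose ?_
  have h := sqrt_two_inv_sq
  ext i j
  rw [mul_conjTranspose_apply, val_quarterTurn]
  fin_cases i <;> fin_cases j <;> simp <;> first | linear_combination 2 * h | ring_nf
  · linear_combination 2 * h - (((Real.sqrt 2 : ℝ) : ℂ)⁻¹ ^ 2) * Complex.I_sq
  · linear_combination 2 * h - (((Real.sqrt 2 : ℝ) : ℂ)⁻¹ ^ 2) * Complex.I_sq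

theorem dact_halfTurn (u : Space) : dact halfTurn basePt u = ![-u 0, u 1, -u 2] := by
  rw [dact_basePt_eq, den_of_act_basePt act_halfTurn, frameNum, val_halfTurn]
  ext k; fin_cases k <;> simp

theorem dact_quarterTurn : dact quarterTurn basePt ![0, 0, 1] = ![0, 1, 0] := by
  have h : (Real.sqrt 2)⁻¹ * (Real.sqrt 2)⁻¹ = 1 / 2 := by
    apply Complex.ofReal_injective
    push_cast
    exact sqrt_two_inv_sq
  rw [dact_basePt_eq, den_of_act_basePt act_quarterTurn, frameNum, val_quarterTurn]
  ext k; fin_cases k <;> simp [← Complex.ofReal_inv]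
  linear_combination 2 * h

theorem quarterTurn_mul_dg : quarterTurn * dg (expU (Real.pi * Complex.I / 2)) =
    halfTurn * quarterTurn := by
  have h : Complex.exp (Real.pi * Complex.I / 2) = Complex.I := by
    rw [mul_div_right_comm]; exact Complex.exp_pi_div_two_mul_I
  apply Subtype.ext
  rw [val_mul, val_mul, val_quarterTurn, val_halfTurn, val_dg, expU_apply, h]
  ext i j
  fin_cases i <;> fin_cases j <;> simp [Matrix.mul_apply, Fin.sum_univ_two, mul_assoc]

/-- Since `W * quarterTurn` takes `e_z` to the axis, the rotation is a conjugate of `diag(i, -i)`,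
which `quarterTurn` conjugates to `halfTurn`. Any other matrix with this axis differs by a diagonal
factor that commutes with `diag(i, -i)`, so no sign is lost. -/
theorem isSpinRotation_iff {W s s' : SL2C} :
    IsSpinRotation (act W basePt) (dact W basePt ![0, 1, 0]) Real.pi s s' ↔
      s' = W * halfTurn * W⁻¹ * s := by
  have hz : dact (W * quarterTurn) basePt ![0, 0, 1] = dact W basePt ![0, 1, 0] := by
    rw [dact_mul _ _ basePt_pos, act_quarterTurn, dact_quarterTurn]
  have hq : act (W * quarterTurn) basePt = act W basePt := by
    rw [act_mul _ _ basePt_pos, act_quarterTurn]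
  have hB : W * quarterTurn * dg (expU (Real.pi * Complex.I / 2)) * (W * quarterTurn)⁻¹ =
      W * halfTurn * W⁻¹ := by
    rw [mul_assoc W, quarterTurn_mul_dg]; group
  constructor
  · rintro ⟨A, B, hA, hAz, hAB, rfl⟩
    obtain ⟨u, -, rfl⟩ := exists_eq_mul_dg (hA.trans hq.symm) (hAz.trans hz.symm)
    rw [isSpinScrew_iff.1 hAB, ← hB, _root_.mul_inv_rev, dg_inv, mul_assoc (W * quarterTurn), ← dg_mul,
      ← mul_assoc, mul_assoc (W * quarterTurn), ← dg_mul, mul_comm u, mul_inv_cancel_right]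
  · rintro rfl
    exact ⟨W * quarterTurn, _, hq, hz, isSpinScrew_iff.2 hB.symm, rfl⟩

theorem Horosphere.centre_eq {κ : Spinor} (hκ : κ ≠ 0) {h : Horosphere}
    (hh : h.carrier = (K κ).carrier) : h.centre = spinorBdry κ := by
  rw [Horosphere.centre, Horosphere.cone_eq hκ hh, boundaryPt_conePt hκ]

/-- A witness `A` pointing at the centre has first column proportional to that of `W`, so `W⁻¹ A` is
upper triangular and fixes the base point. It is therefore unitary diagonal and fixes `e_z`. -/
theorem Horosphere.isOutwardNormal_iff {W : SL2C} {h : Horosphere}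
    (hh : h.carrier = (K (col W)).carrier) {n : Space} :
    h.IsOutwardNormal (act W basePt) n ↔ n = dact W basePt ![0, 0, 1] := by
  constructor
  · rintro ⟨-, -, A, hA, rfl, hc⟩
    rw [Horosphere.centre_eq (col_ne_zero W) hh, actBoundary_infty, eq_comm,
      spinorBdry_eq_iff (col_ne_zero W) (col_ne_zero A)] at hc
    obtain ⟨c, hc⟩ := exists_smul_of_spinorDet (col_ne_zero W) hc
    obtain ⟨k, rfl⟩ : ∃ k, A = W * k := ⟨W⁻¹ * A, by rw [mul_inv_cancel_left]⟩
    have hk := act_basePt_of_mul hA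
    have h10 : k.1 1 0 = 0 := by
      have : col k = c • col 1 := by
        rw [← one_mul k, ← inv_mul_cancel W, mul_assoc, col_mul, hc, mulVec_smul, ← col_mul,
          inv_mul_cancel]
      simpa [col, val_one] using congrFun this 1
    obtain ⟨h1, h2⟩ := unitary_of_act_basePt hk
    have hn := den_of_act_basePt hk
    rw [dact_mul _ _ basePt_pos, hk]
    congr 1
    rw [den, h10, map_zero, zero_add] at hn
    have hn' := hn
    rw [Complex.normSq_apply] at hn'
    rw [dact_basePt_eq, den, h10, hn, frameNum, h10]
    ext i; fin_cases i <;> simp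
    linarith
  · rintro rfl
    refine ⟨isUnitAt_dact_basePt W (by simp [dotProduct, Fin.sum_univ_three]), fun v hv => ?_,
      W, rfl, rfl, ?_⟩
    · obtain ⟨s, t, rfl⟩ := (Horosphere.mem_tangent hh).1 hv
      rw [dact_basePt_dot]; simp [dotProduct, Fin.sum_univ_three]
    · rw [Horosphere.centre_eq (col_ne_zero W) hh, actBoundary_infty]

theorem mul_dg_one (W : SL2C) : W * dg 1 = W := by rw [dg_one, mul_one]

theorem mul_dg_neg_one (W : SL2C) : W * dg (-1) = -W := by rw [dg_neg_one, mul_neg, mul_one]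

/-- The spin decorations lifting the oriented line field of a spinor. -/
theorem SpinDecoratedHorosphere.eq_mul_dg {H : SpinDecoratedHorosphere} {W : SL2C}
    (hH : H.carrier = (K (col W)).carrier) {q : H.carrier} (hq : (q : Space) = act W basePt)
    (hdir : ∀ w, w ∈ (K (col W)).dir q ↔ ∃ c : ℝ, 0 < c ∧ w = c • (frameOf (H.Wout q)).e2) :
    ∃ e : ℂˣ, (e = 1 ∨ e = -1) ∧ H.Wout q = W * dg e ∧ H.Win q = W * halfTurn * dg e := by
  obtain ⟨V, hV, hN⟩ := H.isSpinDecoration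
  obtain ⟨N, hN, hout, -, hrot⟩ := hN q
  have hVu := (hV.1 q).2
  rw [hq, Horosphere.isOutwardNormal_iff hH] at hN
  -- The field and the image of `e_y` are unit vectors, and one is a positive multiple of the other.
  have hVq : V q = dact W basePt ![0, 1, 0] := by
    have hmem : dact W basePt ![0, 1, 0] ∈ (K (col W)).dir q := by
      rw [hq]; exact mem_K_dir.2 ⟨1, one_pos, (one_smul _ _).symm⟩
    obtain ⟨c, hc, hcV⟩ := (hdir _).1 hmem
    rw [hout] at hcV
    dsimp only at hcV
    have hu := isUnitAt_dact_basePt W (u := ![0, 1, 0]) (by simp [dotProduct, Fin.sum_univ_three])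
    rw [hq, IsUnitAt] at hVu
    rw [IsUnitAt, hcV, smul_dotProduct, dotProduct_smul, hVu, smul_eq_mul, smul_eq_mul,
      ← mul_assoc] at hu
    have hpos : 0 < (act W basePt 2) ^ 2 := pow_pos (act_basePt_pos W) 2
    have hc1 : c * c = 1 := by
      exact mul_right_cancel₀ hpos.ne' (by rw [hu, one_mul])
    have : c = 1 := by nlinarith
    rw [hcV, this, one_smul]
  rw [hq, hVq, isSpinRotation_iff] at hrot
  have hpt := congrArg Frame.pt hout
  have he1 := congrArg Frame.e1 hout
  have he2 := congrArg Frame.e2 hout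
  dsimp only [frameOf] at hpt he1 he2
  rw [hrot]
  rcases eq_or_eq_neg (hpt.trans hq) (he1.trans hN) (he2.trans hVq) with h | h
  · refine ⟨1, Or.inl rfl, by rw [h, mul_dg_one], ?_⟩
    rw [h, mul_dg_one, inv_mul_cancel_right]
  · refine ⟨-1, Or.inr rfl, by rw [h, mul_dg_neg_one], ?_⟩
    rw [h, mul_dg_neg_one, mul_neg, inv_mul_cancel_right]

/-! ### Existence of a continuous lift -/

/-- The elements of `SL(2, ℂ)` with first column `κ` taking the base point to `q`. -/
theorem exists_frame (κ : {κ : Spinor // κ ≠ 0}) (q : (K κ.1).carrier) :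
    ∃ W, col W = κ.1 ∧ act W basePt = q := (mem_K_carrier κ.2).1 q.2

/-- The outward spin frame of a spinor at a point of its horosphere. -/
def outFrame (κ : {κ : Spinor // κ ≠ 0}) (q : (K κ.1).carrier) : SL2C := (exists_frame κ q).choose

theorem col_outFrame (κ : {κ : Spinor // κ ≠ 0}) (q : (K κ.1).carrier) :
    col (outFrame κ q) = κ.1 := (exists_frame κ q).choose_spec.1

theorem act_outFrame (κ : {κ : Spinor // κ ≠ 0}) (q : (K κ.1).carrier) :
    act (outFrame κ q) basePt = q := (exists_frame κ q).choose_spec.2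

/-- The point `W p₀` records `W W*`. Combining its columns with the conjugated first column of `W`
cancels the first column and leaves the second times `star (det W) = 1`. This makes the chosen frame
continuous in the spinor and the point. -/
theorem apply_one_eq (W : SL2C) (i : Fin 2) : W.1 i 1 =
    2 * (gInv (fromU (act W basePt)) i 1 * star (col W 0) -
      gInv (fromU (act W basePt)) i 0 * star (col W 1)) := by
  have h : star (W.1 0 0) * star (W.1 1 1) - star (W.1 0 1) * star (W.1 1 0) = 1 := by
    simpa using congrArg star (det_eq W)
  rw [fromU_act_basePt, gInv_actM_hypBase, Matrix.smul_apply, Matrix.smul_apply,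
    mul_conjTranspose_apply, mul_conjTranspose_apply]
  simp only [col, smul_eq_mul]
  linear_combination -W.1 i 1 * h

/-- The total space of the horospheres of spinors. -/
abbrev TotalSpace := {z : {κ : Spinor // κ ≠ 0} × Space // z.2 ∈ (K z.1.1).carrier}

theorem pos_of_mem_K {κ : Spinor} {q : Space} (h : q ∈ (K κ).carrier) : 0 < q 2 := by
  rw [K_carrier] at h
  obtain ⟨x, hx, rfl⟩ := h
  exact toU_pos hx.1

theorem continuous_gInv (i j : Fin 2) : Continuous fun v => gInv v i j := by
  fin_cases i <;> fin_cases j <;> simp [gInv] <;> fun_prop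

theorem continuous_outFrame :
    Continuous fun z : TotalSpace => outFrame z.1.1 ⟨z.1.2, z.2⟩ := by
  have hκ : ∀ i, Continuous fun z : TotalSpace => z.1.1.1 i := fun i =>
    (continuous_apply i).comp (continuous_subtype_val.comp
      (continuous_fst.comp continuous_subtype_val))
  have hq : Continuous fun z : TotalSpace => fromU z.1.2 := by
    rw [continuous_iff_continuousAt]
    intro z
    exact ContinuousAt.comp (f := fun z : TotalSpace => z.1.2)
      (differentiableAt_fromU (pos_of_mem_K z.2)).continuousAt
      (continuous_snd.comp continuous_subtype_val).continuousAt
  have hg : ∀ i j, Continuous fun z : TotalSpace => gInv (fromU z.1.2) i j := fun i j =>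
    (continuous_gInv i j).comp hq
  refine continuous_SL2C fun i j => ?_
  fin_cases j
  · have : (fun z : TotalSpace => (outFrame z.1.1 ⟨z.1.2, z.2⟩).1 i 0) = fun z => z.1.1.1 i := by
      funext z
      exact congrFun (col_outFrame z.1.1 ⟨z.1.2, z.2⟩) i
    exact this ▸ hκ i
  · have : (fun z : TotalSpace => (outFrame z.1.1 ⟨z.1.2, z.2⟩).1 i 1) = fun z =>
        2 * (gInv (fromU z.1.2) i 1 * star (z.1.1.1 0) -
          gInv (fromU z.1.2) i 0 * star (z.1.1.1 1)) := by
      funext z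
      rw [apply_one_eq, col_outFrame, act_outFrame]
    refine this ▸ ?_
    exact continuous_const.mul (((hg i 1).mul (hκ 0).star).sub ((hg i 0).mul (hκ 1).star))

/-- The horosphere of a spinor. -/
abbrev spinorHorosphere (κ : {κ : Spinor // κ ≠ 0}) : Horosphere where
  carrier := (K κ.1).carrier
  isHoro := ⟨conePt κ.1, conePt_mem κ.2, K_carrier κ.1⟩

/-- The unit parallel vector field of a spinor. -/
def parallelField (κ : {κ : Spinor // κ ≠ 0}) (q : (K κ.1).carrier) : Space :=
  dact (outFrame κ q) basePt ![0, 1, 0]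

/-- An eigenvalue is a root of the characteristic polynomial `c² - (tr A) c + 1`, here a perfect
square. -/
theorem eq_or_neg_of_trace {A : SL2C} {κ : Spinor} (hκ : κ ≠ 0) {c : ℂ} (h : A.1 *ᵥ κ = c • κ)
    (ht : A.1.trace = 2 ∨ A.1.trace = -2) : c = 1 ∨ c = -1 := by
  have h0 := congrFun h 0
  have h1 := congrFun h 1
  simp [mulVec, dotProduct, Fin.sum_univ_two] at h0 h1
  have hdet := det_eq A
  rw [trace_fin_two] at ht
  have key : ∀ i, (c ^ 2 - (A.1 0 0 + A.1 1 1) * c + 1) * κ i = 0 := by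
    intro i
    fin_cases i
    · simp only [Fin.zero_eta]
      linear_combination (A.1 1 1 - c) * h0 - A.1 0 1 * h1 - κ 0 * hdet
    · simp only [Fin.mk_one]
      linear_combination (A.1 0 0 - c) * h1 - A.1 1 0 * h0 - κ 1 * hdet
  have hc : c ^ 2 - (A.1 0 0 + A.1 1 1) * c + 1 = 0 := by
    by_contra hne
    exact hκ (funext fun i => (mul_eq_zero.1 (key i)).resolve_left hne)
  rcases ht with ht | ht <;> rw [ht] at hc
  · left
    exact sub_eq_zero.1 (pow_eq_zero_iff two_ne_zero |>.1 (by linear_combination hc))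
  · right
    exact eq_neg_of_add_eq_zero_left
      (pow_eq_zero_iff two_ne_zero |>.1 (by linear_combination hc))

theorem act_image_K (A W : SL2C) :
    act A '' (K (col W)).carrier = (K (col (A * W))).carrier := by
  ext q
  rw [mem_K_carrier (col_ne_zero _)]
  constructor
  · rintro ⟨q, hq, rfl⟩
    obtain ⟨W', hW', rfl⟩ := (mem_K_carrier (col_ne_zero _)).1 hq
    exact ⟨A * W', by rw [col_mul, hW', ← col_mul], act_mul _ _ basePt_pos⟩
  · rintro ⟨W', hW', rfl⟩
    refine ⟨act (A⁻¹ * W') basePt, (mem_K_carrier (col_ne_zero _)).2 ⟨_, ?_, rfl⟩, ?_⟩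
    · rw [col_mul, hW', ← col_mul, inv_mul_cancel_left]
    · rw [← act_mul _ _ basePt_pos, mul_inv_cancel_left]

/-- An isometry `A` that preserves the horosphere preserves its cone point, so `κ` is an
eigenvector; the trace condition makes the eigenvalue `±1`. Thus `A` takes the frame at `q` to the
frame at `q'` up to a sign, which tangent vectors do not see. -/
theorem isUnitParallel_parallelField (κ : {κ : Spinor // κ ≠ 0}) :
    (spinorHorosphere κ).IsUnitParallel (parallelField κ) := by
  constructor
  · intro q
    have hc := col_outFrame κ q
    have ha := act_outFrame κ q
    have hH : (spinorHorosphere κ).carrier = (K (col (outFrame κ q))).carrier := by rw [hc]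
    constructor
    · rw [← ha]
      exact (Horosphere.mem_tangent hH).2 ⟨0, 1, rfl⟩
    · rw [← ha]
      exact isUnitAt_dact_basePt _ (by simp [dotProduct, Fin.sum_univ_three])
  · intro A ht hA q q' hq
    have hc := col_outFrame κ q
    have ha := act_outFrame κ q
    have hcA : (K (col (A * outFrame κ q))).carrier = (K κ.1).carrier := by
      rw [← act_image_K, hc]; exact hA
    have hcone : conePt κ.1 = conePt (col (A * outFrame κ q)) :=
      eq_conePt_of_image (col_ne_zero _) (by rw [hcA, K_carrier])
    obtain ⟨c, hc'⟩ := exists_smul_of_conePt κ.2 (col_ne_zero _) hcone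
    have hact : act (A * outFrame κ q) basePt = act (outFrame κ q') basePt := by
      rw [act_mul _ _ basePt_pos, ha, hq, act_outFrame]
    have hAW : A * outFrame κ q = outFrame κ q' ∨ A * outFrame κ q = -outFrame κ q' := by
      have hm := hc'
      rw [col_mul, hc] at hm
      rcases eq_or_neg_of_trace κ.2 hm ht with rfl | rfl
      · left
        exact eq_of_col_eq (by rw [hc', one_smul, col_outFrame]) hact
      · right
        exact eq_of_col_eq (by rw [hc', neg_smul, one_smul, col_neg, col_outFrame])
          (by rw [hact, act_neg])
    rw [parallelField, parallelField, ← ha, ← dact_mul _ _ basePt_pos]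
    rcases hAW with h | h
    · rw [h]
    · rw [h, dact_neg]

theorem frameOf_eq (W : SL2C) : frameOf W = ⟨act W basePt, dact W basePt ![0, 0, 1],
    dact W basePt ![0, 1, 0],
    hcross (act W basePt) (dact W basePt ![0, 0, 1]) (dact W basePt ![0, 1, 0])⟩ := by
  rw [frameOf, hcross_dact_basePt, cross_apply]
  simp

/-- The spin-decorated horosphere of a spinor. -/
def spinorDecoration (κ : {κ : Spinor // κ ≠ 0}) : SpinDecoratedHorosphere where
  toHorosphere := spinorHorosphere κ
  Win q := outFrame κ q * halfTurn
  Wout q := outFrame κ q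
  continuous_Win := (continuous_outFrame.comp (f := fun q : (K κ.1).carrier =>
    (⟨(κ, q.1), q.2⟩ : TotalSpace)) (by fun_prop)).mul continuous_const
  continuous_Wout := continuous_outFrame.comp (f := fun q : (K κ.1).carrier =>
    (⟨(κ, q.1), q.2⟩ : TotalSpace)) (by fun_prop)
  isSpinDecoration := by
    refine ⟨parallelField κ, isUnitParallel_parallelField κ, fun q =>
      ⟨dact (outFrame κ q) basePt ![0, 0, 1], ?_, ?_, ?_, ?_⟩⟩
    · have hH : (spinorHorosphere κ).carrier = (K (col (outFrame κ q))).carrier := by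
        rw [col_outFrame]
      rw [← act_outFrame κ q, Horosphere.isOutwardNormal_iff hH]
    · rw [frameOf_eq, act_outFrame]; rfl
    · have h1 : dact halfTurn basePt ![0, 0, 1] = -![0, 0, 1] := by
        rw [dact_halfTurn]; ext k; fin_cases k <;> simp
      have h2 : dact halfTurn basePt ![0, 1, 0] = ![0, 1, 0] := by
        rw [dact_halfTurn]; ext k; fin_cases k <;> simp
      rw [frameOf_eq, act_mul _ _ basePt_pos, act_halfTurn, dact_mul _ _ basePt_pos,
        dact_mul _ _ basePt_pos, act_halfTurn, h1, h2, map_neg, act_outFrame]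
      rfl
    · rw [← act_outFrame κ q, parallelField, isSpinRotation_iff, inv_mul_cancel_right]

theorem isSpinLift_spinorDecoration : IsSpinLift spinorDecoration where
  carrier_eq _ := rfl
  dir_eq κ q w := by
    have hc := col_outFrame κ q
    have ha := act_outFrame κ q
    have h := mem_K_dir (W := outFrame κ q) (w := w)
    rw [hc, ha] at h
    exact h
  continuous_Wout := continuous_outFrame
  continuous_Win := continuous_outFrame.mul continuous_const

/-! ### Uniqueness of the lift up to sign -/

theorem continuousAt_toU {v : Mink} (hv : v ∈ hyperboloid) : ContinuousAt toU v :=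
  (differentiableAt_toU hv).continuousAt

theorem continuous_actM_hypBase : Continuous fun A : SL2C => actM A hypBase := by
  have h : ∀ i j, Continuous fun A : SL2C => gInv (actM A hypBase) i j := by
    intro i j
    have he : ∀ i j, Continuous fun A : SL2C => A.1 i j := fun i j =>
      (continuous_subtype_val (X := Matrix (Fin 2) (Fin 2) ℂ)).matrix_elem i j
    have : (fun A : SL2C => gInv (actM A hypBase) i j) =
        fun A => 1 / 2 * (A.1 i 0 * star (A.1 j 0) + A.1 i 1 * star (A.1 j 1)) := by
      funext A
      rw [gInv_actM_hypBase, Matrix.smul_apply, mul_conjTranspose_apply, smul_eq_mul]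
    rw [this]
    exact continuous_const.mul (((he i 0).mul (he j 0).star).add ((he i 1).mul (he j 1).star))
  have hg : (fun A : SL2C => actM A hypBase) = fun A => ![
      (gInv (actM A hypBase) 0 0).re + (gInv (actM A hypBase) 1 1).re,
      2 * (gInv (actM A hypBase) 0 1).re, 2 * (gInv (actM A hypBase) 0 1).im,
      (gInv (actM A hypBase) 0 0).re - (gInv (actM A hypBase) 1 1).re] := by
    funext A
    exact (g_gInv (actM A hypBase)).symm
  rw [hg]
  refine continuous_pi fun k => ?_
  fin_cases k
  · exact (Complex.continuous_re.comp (h 0 0)).add (Complex.continuous_re.comp (h 1 1))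
  · exact continuous_const.mul (Complex.continuous_re.comp (h 0 1))
  · exact continuous_const.mul (Complex.continuous_im.comp (h 0 1))
  · exact (Complex.continuous_re.comp (h 0 0)).sub (Complex.continuous_re.comp (h 1 1))

theorem continuous_act_basePt : Continuous fun A : SL2C => act A basePt := by
  have : (fun A : SL2C => act A basePt) = fun A => toU (actM A hypBase) := funext act_basePt
  rw [this, continuous_iff_continuousAt]
  intro A
  exact ContinuousAt.comp (f := fun A : SL2C => actM A hypBase)
    (continuousAt_toU (actM_hypBase_mem A)) continuous_actM_hypBase.continuousAt

theorem continuous_sec : Continuous sec := by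
  have hκ : ∀ i, Continuous fun κ : {κ : Spinor // κ ≠ 0} => κ.1 i := fun i =>
    (continuous_apply i).comp continuous_subtype_val
  have hS : Continuous fun κ : {κ : Spinor // κ ≠ 0} => (spinorSq κ.1 : ℂ) :=
    Complex.continuous_ofReal.comp ((Complex.continuous_normSq.comp (hκ 0)).add
      (Complex.continuous_normSq.comp (hκ 1)))
  have hS0 : ∀ κ : {κ : Spinor // κ ≠ 0}, (spinorSq κ.1 : ℂ) ≠ 0 := fun κ =>
    mk0_ne (spinorSq_pos κ.2)
  refine continuous_SL2C fun i j => ?_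
  fin_cases i <;> fin_cases j
  · exact hκ 0
  · exact (hκ 1).star.neg.div hS hS0
  · exact hκ 1
  · exact (hκ 0).star.div hS hS0

theorem continuous_uni : Continuous uni := by
  refine continuous_SL2C fun i j => ?_
  fin_cases i <;> fin_cases j
  · exact continuous_const
  · exact continuous_id
  · exact continuous_const
  · exact continuous_const

/-- Every element of `SL(2, ℂ)` is determined by its first column and a complex number. -/
theorem exists_eq_sec_mul_uni (W : SL2C) : ∃ w, W = sec ⟨col W, col_ne_zero W⟩ * uni w := by
  set S := sec ⟨col W, col_ne_zero W⟩ with hS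
  have hc : col (S⁻¹ * W) = col 1 := by
    have : col W = col S := (col_sec ⟨col W, col_ne_zero W⟩).symm
    rw [col_mul, this, ← col_mul, inv_mul_cancel]
  have h0 : (S⁻¹ * W).1 0 0 = 1 := congrFun hc 0
  have h1 : (S⁻¹ * W).1 1 0 = 0 := congrFun hc 1
  have hdet := det_eq (S⁻¹ * W)
  rw [h0, h1, one_mul, mul_zero, sub_zero] at hdet
  refine ⟨(S⁻¹ * W).1 0 1, ?_⟩
  rw [← inv_mul_eq_iff_eq_mul]
  exact SL2C_ext h0 rfl h1 hdet

/-- The complement of a point in a real vector space of dimension `4` is connected. -/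
instance : PreconnectedSpace {κ : Spinor // κ ≠ 0} := by
  have h : IsPreconnected ({0}ᶜ : Set Spinor) := by
    refine (isConnected_compl_singleton_of_one_lt_rank ?_ 0).isPreconnected
    have : Module.finrank ℝ Spinor = 4 := by
      rw [Module.finrank_pi_fintype]; simp
    rw [← Module.finrank_eq_rank, this]
    norm_num
  exact Subtype.preconnectedSpace h

/-- A continuous lift is determined up to a global sign. -/
theorem IsSpinLift.exists_sign {Kt : {κ : Spinor // κ ≠ 0} → SpinDecoratedHorosphere}
    (h : IsSpinLift Kt) : ∃ e : ℂˣ, ∀ (κ : {κ : Spinor // κ ≠ 0}) (W : SL2C), col W = κ.1 →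
      ∀ q : (Kt κ).carrier, (q : Space) = act W basePt →
        (Kt κ).Wout q = W * dg e ∧ (Kt κ).Win q = W * halfTurn * dg e := by
  have hmem : ∀ z : {κ : Spinor // κ ≠ 0} × ℂ, act (sec z.1 * uni z.2) basePt ∈ (Kt z.1).carrier :=
    fun z => by
      rw [h.carrier_eq, mem_K_carrier z.1.2]
      exact ⟨_, by rw [col_mul_uni, col_sec], rfl⟩
  have hloc : ∀ (κ : {κ : Spinor // κ ≠ 0}) (W : SL2C), col W = κ.1 →
      ∀ q : (Kt κ).carrier, (q : Space) = act W basePt →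
      ∃ e : ℂˣ, (e = 1 ∨ e = -1) ∧ (Kt κ).Wout q = W * dg e ∧
        (Kt κ).Win q = W * halfTurn * dg e := by
    rintro κ W hW q hq
    exact SpinDecoratedHorosphere.eq_mul_dg (by rw [hW, h.carrier_eq]) hq
      (by rw [hW]; exact h.dir_eq κ q)
  -- The ratio of the lift to the frame `sec κ * uni w`: a continuous sign on a connected parameter
  -- space that reaches every point of every horosphere.
  set F : {κ : Spinor // κ ≠ 0} × ℂ → SL2C := fun z =>
    (sec z.1 * uni z.2)⁻¹ * (Kt z.1).Wout ⟨_, hmem z⟩ with hF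
  have hsec : Continuous fun z : {κ : Spinor // κ ≠ 0} × ℂ => sec z.1 * uni z.2 :=
    (continuous_sec.comp continuous_fst).mul (continuous_uni.comp continuous_snd)
  have hFc : Continuous F := by
    refine hsec.inv.mul (h.continuous_Wout.comp (f := fun z : {κ : Spinor // κ ≠ 0} × ℂ =>
      (⟨(z.1, act (sec z.1 * uni z.2) basePt), hmem z⟩ :
        {z : {κ : Spinor // κ ≠ 0} × Space // z.2 ∈ (Kt z.1).carrier})) ?_)
    exact (continuous_fst.prodMk (continuous_act_basePt.comp hsec)).subtype_mk _
  have hF1 : ∀ z, F z = 1 ∨ F z = -1 := by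
    intro z
    obtain ⟨e, he, h1, -⟩ := hloc z.1 (sec z.1 * uni z.2) (by rw [col_mul_uni, col_sec])
      ⟨_, hmem z⟩ rfl
    rw [hF]
    dsimp only
    rw [h1, inv_mul_cancel_left]
    rcases he with rfl | rfl
    · left; exact dg_one
    · right; exact dg_neg_one
  have hex : ∃ e : ℂˣ, ∀ z, F z = dg e := by
    have hne : (Pi.single 0 1 : Spinor) ≠ 0 := by simp
    rcases hF1 (⟨_, hne⟩, 0) with h1 | h1
    · exact ⟨1, fun z => by rw [eq_of_sign hFc hF1 z (⟨_, hne⟩, 0), h1, dg_one]⟩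
    · exact ⟨-1, fun z => by rw [eq_of_sign hFc hF1 z (⟨_, hne⟩, 0), h1, dg_neg_one]⟩
  obtain ⟨e, he⟩ := hex
  refine ⟨e, ?_⟩
  rintro ⟨κ, hκ⟩ W rfl ⟨q, hq'⟩ rfl
  obtain ⟨e', -, h1, h2⟩ := hloc ⟨col W, hκ⟩ W rfl ⟨_, hq'⟩ rfl
  obtain ⟨w, hw⟩ := exists_eq_sec_mul_uni W
  have h3 := he (⟨col W, hκ⟩, w)
  have h4 : (Kt ⟨col W, hκ⟩).Wout ⟨act W basePt, hq'⟩ = W * dg e := by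
    rw [← inv_mul_eq_iff_eq_mul, ← h3, hF]
    dsimp only
    congr 2
    exact Subtype.ext (congrArg (fun A => act A basePt) hw)
  have : e' = e := dg_injective (mul_left_cancel (h1.symm.trans h4))
  subst this
  exact ⟨h1, h2⟩

/-! ### Complex lambda lengths -/

theorem mul_halfTurn_apply (W : SL2C) (i : Fin 2) :
    (W * halfTurn).1 i 0 = W.1 i 1 ∧ (W * halfTurn).1 i 1 = -W.1 i 0 := by
  rw [val_mul, val_halfTurn]
  constructor <;> simp [Matrix.mul_apply, Fin.sum_univ_two]

theorem mul_dg_apply (W : SL2C) (v : ℂˣ) (i : Fin 2) :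
    (W * dg v).1 i 0 = W.1 i 0 * v ∧ (W * dg v).1 i 1 = W.1 i 1 * (v : ℂ)⁻¹ := by
  rw [val_mul, val_dg]
  constructor <;> simp [Matrix.mul_apply, Fin.sum_univ_two]

/-- `halfTurn` moves `-κ₁` into the second column, which `dg` scales by the inverse, while `κ₂`
stays in the first. So `e` enters the determinant once as `e` and once as `e⁻¹`. -/
theorem spinorDet_eq_of_isComplexDistance {A W₁ W₂ : SL2C} {e : ℂˣ} {d : ℂ}
    (h : IsComplexDistance A (W₁ * halfTurn * dg e) (W₂ * dg e) d) :
    Complex.exp (d / 2) = spinorDet (col W₁) (col W₂) := by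
  obtain ⟨v₁, v₂, h1, h2, hv⟩ := isComplexDistance_iff.1 h
  have e1 : ∀ i, -W₁.1 i 0 * (e : ℂ)⁻¹ = A.1 i 1 * (v₁ : ℂ)⁻¹ := fun i => by
    rw [← (mul_halfTurn_apply W₁ i).2, ← (mul_dg_apply _ e i).2, h1, (mul_dg_apply _ _ i).2]
  have e2 : ∀ i, W₂.1 i 0 * (e : ℂ) = A.1 i 0 * v₂ := fun i => by
    rw [← (mul_dg_apply _ e i).1, h2, (mul_dg_apply _ _ i).1]
  have he := e.ne_zero
  have hv1 := v₁.ne_zero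
  have hdet := det_eq A
  have e1' : ∀ i, W₁.1 i 0 = -(A.1 i 1 * (v₁ : ℂ)⁻¹ * e) := fun i => by
    rw [← e1 i]; field_simp
  have e2' : ∀ i, W₂.1 i 0 = A.1 i 0 * v₂ * (e : ℂ)⁻¹ := fun i => by
    rw [← e2 i]; field_simp
  simp only [spinorDet, col, e1', e2', hv]
  field_simp
  linear_combination -hdet

/-- The matrix whose columns are proportional to two independent spinors. -/
theorem exists_frame_of_spinorDet_ne {κ₁ κ₂ : Spinor} (h : spinorDet κ₁ κ₂ ≠ 0) :
    ∃ A : SL2C, col A = κ₂ ∧ ∀ i, A.1 i 1 = -κ₁ i / spinorDet κ₁ κ₂ := by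
  refine ⟨⟨!![κ₂ 0, -κ₁ 0 / spinorDet κ₁ κ₂; κ₂ 1, -κ₁ 1 / spinorDet κ₁ κ₂], ?_⟩, ?_, ?_⟩
  · rw [det_fin_two_of]; field_simp; rw [spinorDet]; ring
  · ext i; fin_cases i <;> rfl
  · intro i; fin_cases i <;> rfl

theorem IsSpinLift.isLambdaLength_iff {Kt : {κ : Spinor // κ ≠ 0} → SpinDecoratedHorosphere}
    (h : IsSpinLift Kt) (κ₁ κ₂ : {κ : Spinor // κ ≠ 0}) (l : ℂ) :
    IsLambdaLength (Kt κ₁) (Kt κ₂) l ↔ l = spinorDet κ₁.1 κ₂.1 := by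
  obtain ⟨e, he⟩ := h.exists_sign
  have hc : (Kt κ₁).centre = (Kt κ₂).centre ↔ spinorDet κ₁.1 κ₂.1 = 0 := by
    rw [Horosphere.centre_eq κ₁.2 (h.carrier_eq κ₁), Horosphere.centre_eq κ₂.2 (h.carrier_eq κ₂),
      spinorBdry_eq_iff κ₁.2 κ₂.2]
  rw [IsLambdaLength]
  constructor
  -- Whatever geodesic, points and distance are offered, the two frames have known first columns, so
  -- the value is forced.
  · rintro (⟨h0, rfl⟩ | ⟨-, A, -, -, q₁, q₂, -, -, d, hd, rfl⟩)
    · exact (hc.1 h0).symm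
    · obtain ⟨W₁, hW₁, hq₁⟩ := (mem_K_carrier κ₁.2).1 (by rw [← h.carrier_eq]; exact q₁.2)
      obtain ⟨W₂, hW₂, hq₂⟩ := (mem_K_carrier κ₂.2).1 (by rw [← h.carrier_eq]; exact q₂.2)
      rw [(he κ₁ W₁ hW₁ q₁ hq₁.symm).2, (he κ₂ W₂ hW₂ q₂ hq₂.symm).1] at hd
      rw [spinorDet_eq_of_isComplexDistance hd, hW₁, hW₂]
  · rintro rfl
    by_cases h0 : spinorDet κ₁.1 κ₂.1 = 0
    · exact Or.inl ⟨hc.2 h0, h0⟩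
    obtain ⟨A, hA, hA1⟩ := exists_frame_of_spinorDet_ne h0
    set D : ℂˣ := Units.mk0 _ h0 with hD
    -- `A` has columns `κ₂` and `-κ₁ / D`, so scaling by `dg D⁻¹` makes the second column `-κ₁`, and
    -- undoing `halfTurn` gives first column `κ₁`. The points `W₁ p₀` and `A p₀` both lie on `γ_A`,
    -- at complex distance `2 log D`.
    set W₁ := A * dg D⁻¹ * halfTurn⁻¹ with hW₁
    have hJ : W₁ * halfTurn = A * dg D⁻¹ := inv_mul_cancel_right _ _
    have hcol : col W₁ = κ₁.1 := by
      ext i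
      have h1 := (mul_halfTurn_apply W₁ i).2
      rw [hJ, (mul_dg_apply A _ i).2, hA1] at h1
      have h2 : -κ₁.1 i = -W₁.1 i 0 := by
        rw [← h1, hD]; simp; field_simp
      exact (neg_injective h2).symm
    have hact : act W₁ basePt = act (A * dg D⁻¹) basePt := by
      rw [← hJ, act_mul W₁ halfTurn basePt_pos, act_halfTurn]
    have hm₁ : act W₁ basePt ∈ (Kt κ₁).carrier := by
      rw [h.carrier_eq, ← hcol]; exact mem_K_col W₁
    have hm₂ : act A basePt ∈ (Kt κ₂).carrier := by
      rw [h.carrier_eq, ← hA]; exact mem_K_col A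
    refine Or.inr ⟨fun hh => h0 (hc.1 hh), A, ?_, ?_, ⟨_, hm₁⟩, ⟨_, hm₂⟩, ?_, ?_, 2 * Complex.log D, ?_, ?_⟩
    · have hne : (fun i => A.1 i 1) ≠ 0 := by
        intro hz
        have h2 := det_eq A
        rw [congrFun hz 0, congrFun hz 1] at h2
        simp at h2
      rw [actBoundary_zero, Horosphere.centre_eq κ₁.2 (h.carrier_eq κ₁), spinorBdry_eq_iff hne κ₁.2,
        spinorDet, hA1, hA1]
      ring
    · rw [actBoundary_infty, hA, Horosphere.centre_eq κ₂.2 (h.carrier_eq κ₂)]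
    · dsimp only
      rw [hact]; exact act_mul_dg_mem_range A _
    · have := act_mul_dg_mem_range A 1
      rwa [mul_dg_one] at this
    · rw [(he κ₁ W₁ hcol ⟨_, hm₁⟩ rfl).2, (he κ₂ A hA ⟨_, hm₂⟩ rfl).1, hJ]
      refine isComplexDistance_iff.2 ⟨D⁻¹ * e, e, by rw [dg_mul, mul_assoc], rfl, ?_⟩
      rw [mul_div_cancel_left₀ _ (two_ne_zero (α := ℂ)), Complex.exp_log D.ne_zero, ← Units.val_mul,
        mul_inv_cancel_left]
    · rw [mul_div_cancel_left₀ _ (two_ne_zero (α := ℂ)), Complex.exp_log D.ne_zero]; rfl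

end

end SpinHoro

theorem theorem1p3 :
    (∃ Kt : {κ : SpinHoro.Spinor // κ ≠ 0} → SpinHoro.SpinDecoratedHorosphere,
      SpinHoro.IsSpinLift Kt) ∧
    ∀ Kt : {κ : SpinHoro.Spinor // κ ≠ 0} → SpinHoro.SpinDecoratedHorosphere,
      SpinHoro.IsSpinLift Kt →
      ∀ (κ₁ κ₂ : {κ : SpinHoro.Spinor // κ ≠ 0}) (l : ℂ),
        SpinHoro.IsLambdaLength (Kt κ₁) (Kt κ₂) l ↔ l = SpinHoro.spinorDet κ₁.1 κ₂.1 :=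
  ⟨⟨_, SpinHoro.isSpinLift_spinorDecoration⟩, fun _ h => h.isLambdaLength_iff⟩
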